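/- Let $K\subset\mathbb C$ be a finite set contained in the closed unit disc, and let $\sigma:K^{\mathbb N}\to K^{\mathbb N}$, $(\sigma x)_n=x_{n+1}$, be the shift on the space of one-sided sequences $x=(x_1,x_2,\dots)$ over $K$ with the product topology. A *shift-invariant measure* is a $\sigma$-invariant Borel probability measure on $K^{\mathbb N}$. A *joining* of two shift-invariant measures $\mu,\nu$ is a $(\sigma\times\sigma)$-invariant Borel probability measure $\xi$ on $K^{\mathbb N}\times K^{\mathbb N}$ with marginals $\mu$ and $\nu$. The *correlation* of $\mu$ and $\nu$ is $$\operatorname{Corr}(\mu,\nu)=\sup_{\xi}\left|\int x_1\overline{y_1}\,d\xi(x,y)-\int x_1\,d\mu(x)\cdot\int\overline{y_1}\,d\nu(y)\right|,$$ where $\xi$ ranges over all joinings of $\mu$ and $\nu$; the measures $\mu$ and $\nu$ are *correlated* if $\operatorname{Corr}(\mu,\nu)\neq0$. A *subshift* is a non-empty closed set $X\subset K^{\mathbb N}$ with $\sigma(X)\subset X$; it is *strictly ergodic* if it is minimal (contains no strictly smaller subshift) and carries exactly one shift-invariant probability measure. A shift-invariant measure is *strictly ergodic* if its topological support is a strictly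 ergodic subshift. **Theorem.** Let $\mu$ be a shift-invariant measure on $K^{\mathbb N}$. Then $\mu$ is correlated to some strictly ergodic shift-invariant measure on $K^{\mathbb N}$ if and only if $\mu$ is correlated to some ergodic shift-invariant measure on $K^{\mathbb N}$. -/

import Mathlib

open MeasureTheory

/-- The one-sided full shift space over the finite alphabet `K ⊆ ℂ`, with the product topology and
the product (i.e. Borel) σ-algebra. Sequences are enumerated from `0`, so `x 0` is the first symbol
of `x`. -/
abbrev FullShift (K : Finset ℂ) : Type := ℕ → K

/-- The shift transformation, deleting the first symbol. -/
def shift (K : Finset ℂ) (x : FullShift K) : FullShift K := fun n => x (n + 1)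

/-- Shift-invariant Borel probability measures. -/
structure IsShiftInvariant {K : Finset ℂ} (μ : Measure (FullShift K)) : Prop where
  isProbabilityMeasure : IsProbabilityMeasure μ
  measurePreserving : MeasurePreserving (shift K) μ μ

/-- `ξ` is a joining of `μ` and `ν`: a probability measure on the Cartesian square of the shift
space, invariant under the product of the shifts, with marginals `μ` and `ν`. -/
structure IsJoining {K : Finset ℂ} (ξ : Measure (FullShift K × FullShift K))
    (μ ν : Measure (FullShift K)) : Prop where
  isProbabilityMeasure : IsProbabilityMeasure ξ
  measurePreserving : MeasurePreserving (Prod.map (shift K) (shift K)) ξ ξ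
  map_fst : ξ.map Prod.fst = μ
  map_snd : ξ.map Prod.snd = ν

/-- The correlation of two shift-invariant measures: the supremum over all joinings `ξ` of
`|∫ x₁ conj(y₁) dξ - ∫ x₁ dμ * ∫ conj(y₁) dν|`. For shift-invariant `μ` and `ν` the set of joinings
is non-empty (it contains the product measure) and the values are bounded, as `K` is finite. -/
noncomputable def corr {K : Finset ℂ} (μ ν : Measure (FullShift K)) : ℝ :=
  ⨆ ξ : {ξ : Measure (FullShift K × FullShift K) // IsJoining ξ μ ν},
    ‖(∫ p, (p.1 0 : ℂ) * (starRingEnd ℂ) (p.2 0 : ℂ) ∂ξ.1) -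
      (∫ x, (x 0 : ℂ) ∂μ) * (∫ y, (starRingEnd ℂ) (y 0 : ℂ) ∂ν)‖

/-- Two measures are correlated if their correlation is not zero. -/
def Correlated {K : Finset ℂ} (μ ν : Measure (FullShift K)) : Prop := corr μ ν ≠ 0

/-- A subshift: a non-empty closed set of sequences which is mapped into itself by the shift. -/
structure IsSubshift {K : Finset ℂ} (X : Set (FullShift K)) : Prop where
  nonempty : X.Nonempty
  isClosed : IsClosed X
  mapsTo : Set.MapsTo (shift K) X X

/-- A subshift is strictly ergodic if it is minimal (it contains no smaller subshift) and uniquely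
ergodic (it carries exactly one shift-invariant probability measure). -/
structure IsStrictlyErgodicSubshift {K : Finset ℂ} (X : Set (FullShift K)) : Prop where
  isSubshift : IsSubshift X
  minimal : ∀ Y : Set (FullShift K), IsSubshift Y → Y ⊆ X → Y = X
  uniquelyErgodic : ∃! ρ : Measure (FullShift K), IsShiftInvariant ρ ∧ ρ Xᶜ = 0

/-- Ergodic shift-invariant probability measures. -/
structure IsErgodicMeasure {K : Finset ℂ} (ν : Measure (FullShift K)) : Prop where
  isShiftInvariant : IsShiftInvariant ν
  ergodic : Ergodic (shift K) ν

/-- Strictly ergodic measures: shift-invariant probability measures whose topological support is a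
strictly ergodic subshift. -/
structure IsStrictlyErgodicMeasure {K : Finset ℂ} (ν : Measure (FullShift K)) : Prop where
  isShiftInvariant : IsShiftInvariant ν
  support : IsStrictlyErgodicSubshift ν.support

/-! A strictly ergodic measure is ergodic: conditioning it on an invariant set of positive measure
gives an invariant measure on the same support, hence the measure itself. For the converse, take an
ergodic `ν` and a joining `ξ` of `μ` and `ν` that witnesses the correlation. It suffices to perturb
`ξ` into a joining of `μ` with a strictly ergodic measure, changing only a small proportion of the
symbols in the second coordinate (`exists_isStrictlyErgodicMeasure_joining`).

The perturbation is a coding in the spirit of the Jewett–Krieger theorem. Code words of each level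
are concatenations of code words of the previous level, cut at a phase for which finitely many given
words have almost the same frequency in all new code words. The power `T^[ℓ]` need not be ergodic,
but ergodicity of `T` provides a good phase at most points (`exists_phase_averages`); the remaining
points receive the code word of one fixed good point (`BlockCode.exists_refinement`). With summable
errors, few symbols change in total, and word frequencies become uniform over all windows
(`exists_uniform_coding`).

The coding does not commute with the shift. So the second coordinate of `ξ` is coded, the image is
averaged along orbit segments of the coded length, and a weak limit is taken. The limit is invariant
and keeps the first marginal `μ`; its second marginal lives on a closed set of sequences with
uniform frequencies. Such a set carries at most one invariant measure (`eq_of_uniform_frequencies`),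
whose support is then minimal (`isStrictlyErgodicMeasure_of_unique`). -/

open Filter Topology

/-! ### Mean ergodic averages along powers of an ergodic map. -/

section ErgodicAverages

variable {α : Type*} [MeasurableSpace α] {ν : Measure α}

/-- Von Neumann's mean ergodic theorem for the Koopman operator on `L²`, weakened to convergence in
measure. No ergodicity is assumed, because it is applied to powers of an ergodic map. -/
theorem exists_invariant_tendsto_birkhoffAverage [IsProbabilityMeasure ν] {T : α → α}
    (hT : MeasurePreserving T ν ν) {f : α → ℝ} (hf : MemLp f 2 ν) :
    ∃ F : α → ℝ, Measurable F ∧ Integrable F ν ∧ F ∘ T =ᵐ[ν] F ∧ ∫ x, F x ∂ν = ∫ x, f x ∂ν ∧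
      ∀ ε : ℝ, 0 < ε →
        Tendsto (fun M => ν {x | ε ≤ |birkhoffAverage ℝ T f M x - F x|}) atTop (𝓝 0) := by
  set U : Lp ℝ 2 ν →L[ℝ] Lp ℝ 2 ν :=
    (Lp.compMeasurePreservingₗᵢ ℝ T hT).toContinuousLinearMap with hU
  have hUn : ‖U‖ ≤ 1 := LinearIsometry.norm_toContinuousLinearMap_le _
  have hUapp : ∀ g, U g = Lp.compMeasurePreserving T hT g := fun g => rfl
  set fL : Lp ℝ 2 ν := hf.toLp f
  have key := U.tendsto_birkhoffAverage_orthogonalProjection hUn fL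
  set P := (U.eqLocus (1 : Lp ℝ 2 ν →L[ℝ] Lp ℝ 2 ν)).orthogonalProjectionOnto fL with hP
  have hPfix : U (P : Lp ℝ 2 ν) = P := P.2
  have hiter : ∀ n, ((U^[n] fL : Lp ℝ 2 ν) : α → ℝ) =ᵐ[ν] f ∘ T^[n] := by
    intro n
    induction n with
    | zero => exact hf.coeFn_toLp
    | succ n ih =>
      rw [Function.iterate_succ_apply', hUapp]
      refine (Lp.coeFn_compMeasurePreserving _ hT).trans ?_
      rw [Function.iterate_succ, ← Function.comp_assoc]
      exact hT.quasiMeasurePreserving.ae_eq_comp ih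
  have havg : ∀ M, ((birkhoffAverage ℝ U _root_.id M fL : Lp ℝ 2 ν) : α → ℝ) =ᵐ[ν]
      birkhoffAverage ℝ T f M := by
    intro M
    have hs : ((birkhoffSum U _root_.id M fL : Lp ℝ 2 ν) : α → ℝ) =ᵐ[ν] birkhoffSum T f M := by
      induction M with
      | zero =>
        simp only [birkhoffSum_zero]
        exact Lp.coeFn_zero _ _ _
      | succ M ih =>
        rw [birkhoffSum_succ]
        filter_upwards [Lp.coeFn_add (birkhoffSum U _root_.id M fL) (_root_.id (U^[M] fL)), ih,
          hiter M] with x h1 h2 h3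
        rw [h1, Pi.add_apply, h2, birkhoffSum_succ]
        simp only [_root_.id]
        rw [h3]; rfl
    filter_upwards [Lp.coeFn_smul ((M : ℝ)⁻¹) (birkhoffSum U _root_.id M fL), hs] with x h1 h2
    simp only [birkhoffAverage]
    rw [h1, Pi.smul_apply, h2]
  refine ⟨(P : Lp ℝ 2 ν), (Lp.stronglyMeasurable _).measurable, ?_, ?_, ?_, ?_⟩
  · exact (Lp.memLp _).integrable (by norm_num)
  · have := Lp.coeFn_compMeasurePreserving (P : Lp ℝ 2 ν) hT
    rw [← hUapp, hPfix] at this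
    exact this.symm
  -- Constants are fixed by the Koopman operator, so the projection preserves the inner product with
  -- `1`, that is, the integral.
  · have h1 : indicatorConstLp 2 (μ := ν) MeasurableSet.univ (measure_ne_top _ _) (1 : ℝ) ∈
        U.eqLocus (1 : Lp ℝ 2 ν →L[ℝ] Lp ℝ 2 ν) := by
      change U _ = _
      rw [hUapp, Lp.indicatorConstLp_compMeasurePreserving]
      rfl
    have h2 := Submodule.inner_orthogonalProjectionOnto_eq_of_mem_left ⟨_, h1⟩ fL
    rw [← hP, L2.inner_indicatorConstLp_one] at h2
    have h3 : inner ℝ (indicatorConstLp 2 (μ := ν) MeasurableSet.univ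
      (measure_ne_top _ _) (1 : ℝ)) (P : Lp ℝ 2 ν) = inner ℝ (indicatorConstLp 2 (μ := ν) MeasurableSet.univ
      (measure_ne_top _ _) (1 : ℝ)) fL := h2.trans (by rw [L2.inner_indicatorConstLp_one])
    rw [L2.inner_indicatorConstLp_one, L2.inner_indicatorConstLp_one] at h3
    simp only [Measure.restrict_univ] at h3
    rw [h3]
    exact integral_congr_ae hf.coeFn_toLp
  · intro ε hε
    have h1 := tendstoInMeasure_of_tendsto_Lp key
    have h2 := h1 (ENNReal.ofReal ε) (by simpa using hε)
    refine h2.congr fun M => measure_congr (eventuallyEq_set.2 ?_)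
    filter_upwards [havg M] with x hx
    simp only [hx]
    rw [edist_dist, Real.dist_eq, ENNReal.ofReal_le_ofReal_iff (abs_nonneg _)]

/-- The limits of the averages along `T^[ℓ]` are `T^[ℓ]`-invariant functions. A set `G` of positive
measure on which they are almost constant, with the limit for `h` at most its mean, is
`T^[ℓ]`-invariant mod null sets; its preimages under `ℓ` consecutive iterates then form a
`T`-invariant union, of full measure by ergodicity. Phases start at `ℓ` rather than `0` so that the
piece before the first cut is itself long enough to be a code word. -/
theorem exists_phase_averages [IsProbabilityMeasure ν] {T : α → α} (hT : Ergodic T ν) {ℓ : ℕ}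
    {ι : Type*} [Finite ι] {f : ι → α → ℝ} (hf : ∀ j, MemLp (f j) 2 ν) {h : α → ℝ}
    (hh : MemLp h 2 ν) (hℓ : 0 < ℓ) {δ : ℝ} (hδ : 0 < δ) :
    ∃ p : ι → ℝ, ∀ η : ENNReal, 0 < η → ∀ᶠ M in atTop, ν {x | ¬ ∃ i, ℓ ≤ i ∧ i < 2 * ℓ ∧
      (∀ j, |birkhoffAverage ℝ T^[ℓ] (f j) M (T^[i] x) - p j| ≤ δ) ∧
      birkhoffAverage ℝ T^[ℓ] h M (T^[i] x) ≤ ∫ x, h x ∂ν + δ} ≤ η := by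
  have hTm := hT.toMeasurePreserving
  choose F hFm hFi hFT _ hF using fun j =>
    exists_invariant_tendsto_birkhoffAverage (hTm.iterate ℓ) (hf j)
  obtain ⟨H, hHm, hHi, hHT, hHint, hH⟩ :=
    exists_invariant_tendsto_birkhoffAverage (hTm.iterate ℓ) hh
  have hpos := measure_le_integral_pos hHi
  -- Rational centres make the cover countable, so one of its members has positive measure.
  have hcov : {x | H x ≤ ∫ a, H a ∂ν} ⊆ ⋃ q : ι → ℚ,
      {x | H x ≤ ∫ a, H a ∂ν ∧ ∀ j, |F j x - q j| ≤ δ / 2} := by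
    intro x hx
    choose q hq using fun j => exists_rat_near (F j x) (half_pos hδ)
    exact Set.mem_iUnion.2 ⟨q, hx, fun j => (hq j).le⟩
  obtain ⟨q, hq⟩ : ∃ q : ι → ℚ,
      0 < ν {x | H x ≤ ∫ a, H a ∂ν ∧ ∀ j, |F j x - q j| ≤ δ / 2} := by
    refine exists_measure_pos_of_not_measure_iUnion_null fun h0 => ?_
    exact hpos.ne' (measure_mono_null hcov h0)
  set G := {x | H x ≤ ∫ a, H a ∂ν ∧ ∀ j, |F j x - q j| ≤ δ / 2} with hG
  have hGm : MeasurableSet G := by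
    have : G = {x | H x ≤ ∫ a, H a ∂ν} ∩ ⋂ j, {x | |F j x - q j| ≤ δ / 2} := by
      ext; simp [hG]
    rw [this]
    refine (measurableSet_le hHm measurable_const).inter (MeasurableSet.iInter fun j => ?_)
    exact measurableSet_le ((hFm j).sub_const _).abs measurable_const
  have hGinv : ∀ᵐ x ∂ν, T^[ℓ] x ∈ G ↔ x ∈ G := by
    filter_upwards [hHT, ae_all_iff.2 hFT] with x h1 h2
    simp only [Function.comp_apply] at h1 h2
    simp only [hG, Set.mem_ofPred_eq, h1, h2]
  set V : Set α := ⋃ i ∈ Finset.Ico ℓ (2 * ℓ), T^[i] ⁻¹' G with hV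
  have hVm : MeasurableSet V :=
    Finset.measurableSet_biUnion _ fun i _ => (hTm.iterate i).measurable hGm
  have hVle : T ⁻¹' V ≤ᵐ[ν] V := by
    have := ((hTm.iterate ℓ).quasiMeasurePreserving.ae hGinv)
    filter_upwards [this] with x hx hxV
    have hxV : x ∈ T ⁻¹' V := hxV
    change x ∈ V
    simp only [hV, Set.mem_preimage, Set.mem_iUnion, Finset.mem_Ico, exists_prop,
      ← Function.iterate_succ_apply] at hxV ⊢
    obtain ⟨i, ⟨hi1, hi2⟩, hi⟩ := hxV
    by_cases hi3 : i + 1 < 2 * ℓ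
    · exact ⟨i + 1, ⟨by omega, hi3⟩, hi⟩
    -- The phase `2 * ℓ` wraps around to `ℓ` by the `T^[ℓ]`-invariance of `G`.
    · refine ⟨ℓ, ⟨le_rfl, by omega⟩, hx.1 ?_⟩
      rw [← Function.iterate_add_apply]
      convert hi using 2
      omega
  have hVfull : ∀ᵐ x ∂ν, x ∈ V := by
    rcases hT.ae_empty_or_univ_of_preimage_ae_le hVm.nullMeasurableSet hVle with h0 | h1
    · exfalso
      have h2 : ν V = 0 := by rw [measure_congr h0]; simp
      have h3 : ν (T^[ℓ] ⁻¹' G) = 0 := by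
        refine measure_mono_null ?_ h2
        exact Set.subset_biUnion_of_mem (u := fun i => T^[i] ⁻¹' G)
          (show ℓ ∈ (Finset.Ico ℓ (2 * ℓ) : Set ℕ) by simp; omega)
      rw [(hTm.iterate ℓ).measure_preimage hGm.nullMeasurableSet] at h3
      exact hq.ne' h3
    · exact eventuallyEq_univ.1 h1
  refine ⟨fun j => q j, fun η hη => ?_⟩
  have := Fintype.ofFinite ι
  let bad : ℕ → Set α := fun M => {x | δ / 2 ≤ |birkhoffAverage ℝ T^[ℓ] h M x - H x|} ∪
    ⋃ j, {x | δ / 2 ≤ |birkhoffAverage ℝ T^[ℓ] (f j) M x - F j x|}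
  have hbad : Tendsto (fun M => ν {x | δ / 2 ≤ |birkhoffAverage ℝ T^[ℓ] h M x - H x|} +
    ∑ j, ν {x | δ / 2 ≤ |birkhoffAverage ℝ T^[ℓ] (f j) M x - F j x|}) atTop (𝓝 0) := by
    have := (hH _ (half_pos hδ)).add
      (tendsto_finsetSum Finset.univ fun j _ => hF j _ (half_pos hδ))
    simpa using this
  -- The factor `ℓ` pays for the union bound over all phases.
  have hbad2 : Tendsto (fun M => (ℓ : ENNReal) *
    (ν {x | δ / 2 ≤ |birkhoffAverage ℝ T^[ℓ] h M x - H x|} +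
    ∑ j, ν {x | δ / 2 ≤ |birkhoffAverage ℝ T^[ℓ] (f j) M x - F j x|})) atTop (𝓝 0) := by
    have := ENNReal.Tendsto.const_mul (a := (ℓ : ENNReal)) hbad (Or.inr (by simp))
    simpa using this
  filter_upwards [hbad2.eventually (ge_mem_nhds hη)] with M hM
  refine le_trans ?_ hM
  have hsub : ν {x | ¬ ∃ i, ℓ ≤ i ∧ i < 2 * ℓ ∧
      (∀ j, |birkhoffAverage ℝ T^[ℓ] (f j) M (T^[i] x) - q j| ≤ δ) ∧
      birkhoffAverage ℝ T^[ℓ] h M (T^[i] x) ≤ ∫ x, h x ∂ν + δ} ≤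
      ν (⋃ i ∈ Finset.Ico ℓ (2 * ℓ), T^[i] ⁻¹' bad M) := by
    refine measure_mono_ae ?_
    filter_upwards [hVfull] with x hxV hx
    have hx : ¬ ∃ i, ℓ ≤ i ∧ i < 2 * ℓ ∧
      (∀ j, |birkhoffAverage ℝ T^[ℓ] (f j) M (T^[i] x) - q j| ≤ δ) ∧
      birkhoffAverage ℝ T^[ℓ] h M (T^[i] x) ≤ ∫ x, h x ∂ν + δ := hx
    simp only [hV, Set.mem_preimage, Set.mem_iUnion, Finset.mem_Ico, exists_prop] at hxV
    obtain ⟨i, ⟨hi1, hi2⟩, hiH, hiF⟩ := hxV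
    change x ∈ ⋃ i ∈ Finset.Ico ℓ (2 * ℓ), T^[i] ⁻¹' bad M
    refine Set.mem_biUnion (x := i) (by simp [hi1, hi2]) ?_
    by_contra hb
    simp only [bad, Set.mem_preimage, Set.mem_union, Set.mem_iUnion, Set.mem_ofPred_eq, not_or,
      not_le, not_exists] at hb
    refine hx ⟨i, hi1, hi2, fun j => ?_, ?_⟩
    · have h1 := abs_le.1 (hiF j)
      have h2 := abs_lt.1 (hb.2 j)
      rw [abs_le]; constructor <;> linarith
    · have h2 := abs_lt.1 hb.1
      rw [← hHint]; linarith
  refine hsub.trans ((measure_biUnion_finset_le _ _).trans ?_)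
  have h1 : ∀ i ∈ Finset.Ico ℓ (2 * ℓ), ν (T^[i] ⁻¹' bad M) ≤
      ν {x | δ / 2 ≤ |birkhoffAverage ℝ T^[ℓ] h M x - H x|} +
    ∑ j, ν {x | δ / 2 ≤ |birkhoffAverage ℝ T^[ℓ] (f j) M x - F j x|} := by
    intro i _
    refine ((hTm.iterate i).measure_preimage_le _).trans ?_
    refine (measure_union_le _ _).trans ?_
    gcongr
    exact (measure_iUnion_le _).trans (by rw [tsum_fintype])
  refine (Finset.sum_le_sum h1).trans ?_
  rw [Finset.sum_const, Nat.card_Ico, nsmul_eq_mul]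
  gcongr
  omega

end ErgodicAverages

/-! ### Birkhoff sums cut into blocks. -/

section BirkhoffSums

variable {α : Type*} {f : α → α} {g : α → ℝ}

theorem birkhoffSum_nonneg_of_nonneg (hg : ∀ x, 0 ≤ g x) (n : ℕ) (x : α) :
    0 ≤ birkhoffSum f g n x :=
  Finset.sum_nonneg fun _ _ => hg _

theorem birkhoffSum_le_of_le_one (hg : ∀ x, g x ≤ 1) (n : ℕ) (x : α) :
    birkhoffSum f g n x ≤ n := by
  refine (Finset.sum_le_sum fun _ _ => hg _).trans ?_
  simp

theorem birkhoffSum_mul_eq_sum (M ℓ : ℕ) (x : α) :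
    birkhoffSum f g (M * ℓ) x = ∑ j ∈ Finset.range M, birkhoffSum f g ℓ (f^[j * ℓ] x) := by
  induction M with
  | zero => simp
  | succ M ih => rw [Nat.succ_mul, birkhoffSum_add, Finset.sum_range_succ, ih]

theorem birkhoffSum_blocks_bounds (h0 : ∀ x, 0 ≤ g x) (h1 : ∀ x, g x ≤ 1) (i M ℓ r : ℕ) (x : α) :
    ∑ j ∈ Finset.range M, birkhoffSum f g ℓ (f^[i + j * ℓ] x) ≤
        birkhoffSum f g (i + M * ℓ + r) x ∧
      birkhoffSum f g (i + M * ℓ + r) x ≤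
        ∑ j ∈ Finset.range M, birkhoffSum f g ℓ (f^[i + j * ℓ] x) + (i + r) := by
  have : ∑ j ∈ Finset.range M, birkhoffSum f g ℓ (f^[i + j * ℓ] x) =
      birkhoffSum f g (M * ℓ) (f^[i] x) := by
    rw [birkhoffSum_mul_eq_sum]
    refine Finset.sum_congr rfl fun j _ => ?_
    rw [add_comm i, Function.iterate_add_apply]
  rw [this, birkhoffSum_add, birkhoffSum_add]
  have a1 := birkhoffSum_nonneg_of_nonneg (f := f) h0 i x
  have a2 := birkhoffSum_le_of_le_one (f := f) h1 i x
  have a3 := birkhoffSum_nonneg_of_nonneg (f := f) h0 r (f^[i + M * ℓ] x)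
  have a4 := birkhoffSum_le_of_le_one (f := f) h1 r (f^[i + M * ℓ] x)
  constructor <;> linarith

theorem nat_mul_birkhoffAverage_iterate (ℓ i M : ℕ) (x : α) :
    (M : ℝ) * birkhoffAverage ℝ f^[ℓ] g M (f^[i] x) =
      ∑ j ∈ Finset.range M, g (f^[i + j * ℓ] x) := by
  rcases Nat.eq_zero_or_pos M with rfl | hM
  · simp
  have hM' : (M : ℝ) ≠ 0 := by positivity
  rw [birkhoffAverage, smul_eq_mul, mul_inv_cancel_left₀ hM', birkhoffSum]
  refine Finset.sum_congr rfl fun j _ => ?_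
  rw [← Function.iterate_mul, ← Function.iterate_add_apply, add_comm, mul_comm]

theorem measurable_birkhoffSum [MeasurableSpace α] (hf : Measurable f) (hg : Measurable g)
    (n : ℕ) : Measurable (birkhoffSum f g n) := by
  unfold birkhoffSum
  exact Finset.measurable_sum _ fun k _ => hg.comp (hf.iterate k)

end BirkhoffSums

/-! ### Word counts and Hamming distances in the shift space. -/

variable {K : Finset ℂ}

theorem shift_iterate_apply (n m : ℕ) (x : FullShift K) : (shift K)^[n] x m = x (n + m) := by
  induction n generalizing x with
  | zero => simp
  | succ n ih =>
    rw [Function.iterate_succ_apply, ih]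
    change x (n + m + 1) = _
    congr 1
    omega

theorem continuous_shift : Continuous (shift K) := by
  unfold shift
  fun_prop

theorem measurable_shift : Measurable (shift K) := by
  unfold shift
  fun_prop

/-- A finite word over `K`. -/
abbrev Word (K : Finset ℂ) : Type := Σ m : ℕ, Fin m → K

open Classical in
/-- The indicator function of the cylinder set of a word. -/
noncomputable def cylInd (v : Word K) (z : FullShift K) : ℝ :=
  if ∀ i : Fin v.1, z i = v.2 i then 1 else 0

/-- The number of occurrences of a word starting in the first `b` positions. -/
noncomputable def occ (v : Word K) (b : ℕ) (z : FullShift K) : ℝ :=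
  birkhoffSum (shift K) (cylInd v) b z

open Classical in
/-- The indicator of a mismatch at the first symbol. -/
noncomputable def mismatchInd (p : FullShift K × FullShift K) : ℝ :=
  if p.1 0 = p.2 0 then 0 else 1

/-- The Hamming distance of the initial words of length `b`. -/
noncomputable def mismatch (b : ℕ) (x y : FullShift K) : ℝ :=
  birkhoffSum (Prod.map (shift K) (shift K)) mismatchInd b (x, y)

theorem cylInd_nonneg (v : Word K) (z : FullShift K) : 0 ≤ cylInd v z := by
  unfold cylInd; split_ifs <;> norm_num

theorem cylInd_le_one (v : Word K) (z : FullShift K) : cylInd v z ≤ 1 := by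
  unfold cylInd; split_ifs <;> norm_num

theorem mismatchInd_nonneg (p : FullShift K × FullShift K) : 0 ≤ mismatchInd p := by
  unfold mismatchInd; split_ifs <;> norm_num

theorem mismatchInd_le_one (p : FullShift K × FullShift K) : mismatchInd p ≤ 1 := by
  unfold mismatchInd; split_ifs <;> norm_num

theorem isClopen_cylinder (v : Word K) : IsClopen {z : FullShift K | ∀ i : Fin v.1, z i = v.2 i} := by
  have : {z : FullShift K | ∀ i : Fin v.1, z i = v.2 i} =
      ⋂ i : Fin v.1, (fun z : FullShift K => z i) ⁻¹' {v.2 i} := by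
    ext; simp
  rw [this]
  exact isClopen_iInter_of_finite fun i => (isClopen_discrete _).preimage (continuous_apply _)

theorem cylInd_eq_indicator (v : Word K) :
    cylInd v = Set.indicator {z : FullShift K | ∀ i : Fin v.1, z i = v.2 i} 1 := by
  ext z
  simp [cylInd, Set.indicator_apply]

theorem continuous_cylInd (v : Word K) : Continuous (cylInd v) := by
  rw [cylInd_eq_indicator]
  exact continuous_one.indicator fun x hx => by simp [(isClopen_cylinder v).frontier_eq] at hx

theorem measurable_cylInd (v : Word K) : Measurable (cylInd v) :=
  (continuous_cylInd v).measurable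

theorem measurable_mismatchInd : Measurable (mismatchInd (K := K)) := by
  unfold mismatchInd
  refine Measurable.ite ?_ measurable_const measurable_const
  exact measurableSet_eq_fun (by fun_prop) (by fun_prop)

theorem measurable_occ (v : Word K) (b : ℕ) : Measurable (occ v b) :=
  measurable_birkhoffSum measurable_shift (measurable_cylInd v) b

theorem occ_nonneg (v : Word K) (b : ℕ) (z : FullShift K) : 0 ≤ occ v b z :=
  birkhoffSum_nonneg_of_nonneg (cylInd_nonneg v) b z

theorem occ_le (v : Word K) (b : ℕ) (z : FullShift K) : occ v b z ≤ b :=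
  birkhoffSum_le_of_le_one (cylInd_le_one v) b z

theorem mismatch_nonneg (b : ℕ) (x y : FullShift K) : 0 ≤ mismatch b x y :=
  birkhoffSum_nonneg_of_nonneg mismatchInd_nonneg b _

theorem mismatch_le (b : ℕ) (x y : FullShift K) : mismatch b x y ≤ b :=
  birkhoffSum_le_of_le_one mismatchInd_le_one b _

theorem measurable_mismatch (b : ℕ) : Measurable fun p : FullShift K × FullShift K =>
    mismatch b p.1 p.2 :=
  measurable_birkhoffSum (measurable_shift.prodMap measurable_shift) measurable_mismatchInd b

theorem mismatch_eq_sum (b : ℕ) (x y : FullShift K) : mismatch b x y =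
    ∑ t ∈ Finset.range b, mismatchInd ((shift K)^[t] x, (shift K)^[t] y) := by
  simp only [mismatch, birkhoffSum, Prod.map_iterate, Prod.map]

theorem mismatch_congr_right {b : ℕ} {x y y' : FullShift K} (h : ∀ m < b, y m = y' m) :
    mismatch b x y = mismatch b x y' := by
  simp only [mismatch_eq_sum]
  refine Finset.sum_congr rfl fun t ht => ?_
  simp only [mismatchInd, shift_iterate_apply, add_zero, h t (Finset.mem_range.1 ht)]

/-- Only occurrences starting at the last `v.1` positions can see symbols beyond the first `b`. -/
theorem abs_occ_sub_le {v : Word K} {b : ℕ} {z z' : FullShift K} (h : ∀ m < b, z m = z' m) :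
    |occ v b z - occ v b z'| ≤ v.1 := by
  classical
  simp only [occ, birkhoffSum, ← Finset.sum_sub_distrib]
  have h1 : ∀ t ∈ Finset.range b, |cylInd v ((shift K)^[t] z) - cylInd v ((shift K)^[t] z')| ≤
      if b < t + v.1 then 1 else 0 := by
    intro t _
    split_ifs with hb
    · have a1 := cylInd_nonneg v ((shift K)^[t] z)
      have a2 := cylInd_nonneg v ((shift K)^[t] z')
      have a3 := cylInd_le_one v ((shift K)^[t] z)
      have a4 := cylInd_le_one v ((shift K)^[t] z')
      rw [abs_le]; constructor <;> linarith
    · have : cylInd v ((shift K)^[t] z) = cylInd v ((shift K)^[t] z') := by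
        unfold cylInd
        have : ∀ i : Fin v.1, (shift K)^[t] z i = (shift K)^[t] z' i := fun i => by
          rw [shift_iterate_apply, shift_iterate_apply]
          exact h _ (by have := i.2; omega)
        simp only [this]
      simp [this]
  refine (Finset.abs_sum_le_sum_abs _ _).trans ((Finset.sum_le_sum h1).trans ?_)
  rw [Finset.sum_ite, Finset.sum_const_zero, add_zero, Finset.sum_const, nsmul_eq_mul, mul_one,
    Nat.cast_le]
  have : (Finset.range b).filter (fun t => b < t + v.1) ⊆ Finset.Ico (b - v.1) b := by
    intro t ht
    simp only [Finset.mem_filter, Finset.mem_range, Finset.mem_Ico] at ht ⊢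
    omega
  refine (Finset.card_le_card this).trans ?_
  rw [Nat.card_Ico]; omega

/-! ### Block codes and their refinement. -/

/-- A code assigning to every point `x` and every length `b` the first `b` symbols of `code b x`;
the relevant lengths are those between `len` and `3 * len`. -/
structure BlockCode (K : Finset ℂ) where
  len : ℕ
  len_pos : 0 < len
  code : ℕ → FullShift K → FullShift K
  measurable_code : ∀ b, Measurable (code b)

namespace BlockCode

variable (s : BlockCode K)

/-- The word of `z` at the positions from `a` to `c - 1` is a code word of `s`. -/
def IsBlock (z : FullShift K) (a c : ℕ) : Prop :=
  ∃ b x, s.len ≤ b ∧ b ≤ 3 * s.len ∧ c = a + b ∧ ∀ m < b, z (a + m) = s.code b x m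

/-- The expected fraction of symbols changed by the code. -/
noncomputable def err (ν : Measure (FullShift K)) : ℝ :=
  (∫ x, mismatch s.len x (s.code s.len x) ∂ν) / s.len

/-- A concatenation of code words of total length `b`: the first has length `i`, it is followed by
`M` words of length `len`, and by a last word. -/
def concat (b M i : ℕ) (x : FullShift K) : FullShift K := fun m =>
  if m < i then s.code i x m
  else if m < i + M * s.len then
    s.code s.len ((shift K)^[i + (m - i) / s.len * s.len] x) ((m - i) % s.len)
  else s.code (b - (i + M * s.len)) ((shift K)^[i + M * s.len] x) (m - (i + M * s.len))

theorem measurable_concat (b M i : ℕ) : Measurable (s.concat b M i) := by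
  refine measurable_pi_iff.2 fun m => ?_
  unfold concat
  have h : ∀ b' n m', Measurable fun x => s.code b' ((shift K)^[n] x) m' := fun b' n m' =>
    (measurable_pi_apply m').comp ((s.measurable_code b').comp (measurable_shift.iterate n))
  split_ifs
  · exact h i 0 m
  · exact h _ _ _
  · exact h _ _ _

theorem concat_left {b M i m : ℕ} (x : FullShift K) (h : m < i) :
    s.concat b M i x m = s.code i x m := by
  simp [concat, h]

theorem concat_mid {b M i j r : ℕ} (x : FullShift K) (hj : j < M) (hr : r < s.len) :
    s.concat b M i x (i + j * s.len + r) = s.code s.len ((shift K)^[i + j * s.len] x) r := by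
  have h1 : ¬ i + j * s.len + r < i := by omega
  have h2 : i + j * s.len + r < i + M * s.len := by
    have : (j + 1) * s.len ≤ M * s.len := Nat.mul_le_mul_right _ hj
    rw [Nat.succ_mul] at this
    omega
  have h3 : i + j * s.len + r - i = r + s.len * j := by rw [mul_comm s.len]; omega
  have h4 : (r + s.len * j) / s.len = j := by
    rw [Nat.add_mul_div_left _ _ s.len_pos, Nat.div_eq_of_lt hr, zero_add]
  have h5 : (r + s.len * j) % s.len = r := by
    rw [Nat.add_mul_mod_self_left, Nat.mod_eq_of_lt hr]
  simp only [concat, h1, h2, if_true, if_false, h3, h4, h5]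

theorem concat_right {b M i m : ℕ} (x : FullShift K) :
    s.concat b M i x (i + M * s.len + m) =
      s.code (b - (i + M * s.len)) ((shift K)^[i + M * s.len] x) m := by
  have h1 : ¬ i + M * s.len + m < i := by omega
  have h2 : ¬ i + M * s.len + m < i + M * s.len := by omega
  simp only [concat, h1, h2, if_false, Nat.add_sub_cancel_left]

theorem reflTransGen_isBlock_of_concat {b M i r : ℕ} {x z : FullShift K} {a : ℕ}
    (hz : ∀ m < b, z (a + m) = s.concat b M i x m) (hb : b = i + M * s.len + r)
    (hi : s.len ≤ i) (hi' : i ≤ 3 * s.len) (hr : s.len ≤ r) (hr' : r ≤ 3 * s.len) :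
    Relation.ReflTransGen (s.IsBlock z) a (a + b) := by
  have hmid : ∀ j ≤ M, Relation.ReflTransGen (s.IsBlock z) a (a + (i + j * s.len)) := by
    intro j hj
    induction j with
    | zero =>
      refine Relation.ReflTransGen.single ⟨i, x, hi, hi', by simp, fun m hm => ?_⟩
      rw [hz m (by omega), concat_left _ _ hm]
    | succ j ih =>
      refine (ih (by omega)).tail ⟨s.len, (shift K)^[i + j * s.len] x, le_rfl, by omega,
        by rw [Nat.succ_mul]; omega, fun m hm => ?_⟩
      have : (j + 1) * s.len ≤ M * s.len := Nat.mul_le_mul_right _ hj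
      rw [Nat.succ_mul] at this
      rw [add_assoc, hz _ (by omega), concat_mid _ _ (by omega) hm]
  refine (hmid M le_rfl).tail ⟨r, (shift K)^[i + M * s.len] x, hr, hr', by omega, fun m hm => ?_⟩
  rw [add_assoc, hz _ (by omega), concat_right]
  congr
  omega

/-- Each middle block costs at most `v.1` for occurrences crossing its right end; the outer pieces
cost at most their lengths. -/
theorem abs_occ_concat_sub_le {b M i r : ℕ} (x : FullShift K) (hb : b = i + M * s.len + r)
    (v : Word K) :
    |occ v b (s.concat b M i x) - ∑ j ∈ Finset.range M,
      occ v s.len (s.code s.len ((shift K)^[i + j * s.len] x))| ≤ M * v.1 + (i + r) := by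
  have h1 := birkhoffSum_blocks_bounds (f := shift K) (cylInd_nonneg v) (cylInd_le_one v)
    i M s.len r (s.concat b M i x)
  rw [← hb] at h1
  have h2 : |∑ j ∈ Finset.range M, birkhoffSum (shift K) (cylInd v) s.len
        ((shift K)^[i + j * s.len] (s.concat b M i x)) -
      ∑ j ∈ Finset.range M, occ v s.len (s.code s.len ((shift K)^[i + j * s.len] x))| ≤
      M * v.1 := by
    rw [← Finset.sum_sub_distrib]
    refine (Finset.abs_sum_le_sum_abs _ _).trans ?_
    have : ∀ j ∈ Finset.range M, |birkhoffSum (shift K) (cylInd v) s.len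
        ((shift K)^[i + j * s.len] (s.concat b M i x)) -
      occ v s.len (s.code s.len ((shift K)^[i + j * s.len] x))| ≤ v.1 := fun j hj => by
      refine abs_occ_sub_le fun m hm => ?_
      rw [shift_iterate_apply, concat_mid _ _ (Finset.mem_range.1 hj) hm]
    refine (Finset.sum_le_sum this).trans ?_
    simp
  rw [abs_le] at h2 ⊢
  simp only [occ] at h2 ⊢
  have : (0 : ℝ) ≤ i + r := by positivity
  constructor <;> linarith

/-- Mismatches are counted symbol by symbol, so junctions cost nothing and only the outer pieces are
estimated trivially. -/
theorem mismatch_concat_le {b M i r : ℕ} (x : FullShift K) (hb : b = i + M * s.len + r) :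
    mismatch b x (s.concat b M i x) ≤ ∑ j ∈ Finset.range M,
      mismatch s.len ((shift K)^[i + j * s.len] x)
        (s.code s.len ((shift K)^[i + j * s.len] x)) + (i + r) := by
  have h1 := (birkhoffSum_blocks_bounds (f := Prod.map (shift K) (shift K)) mismatchInd_nonneg
    mismatchInd_le_one i M s.len r (x, s.concat b M i x)).2
  rw [← hb] at h1
  refine h1.trans (le_of_eq ?_)
  congr 1
  refine Finset.sum_congr rfl fun j hj => ?_
  rw [Prod.map_iterate, Prod.map]
  refine mismatch_congr_right fun m hm => ?_
  rw [shift_iterate_apply, concat_mid _ _ (Finset.mem_range.1 hj) hm]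

end BlockCode

theorem memLp_of_nonneg_of_le {α : Type*} [MeasurableSpace α] {ν : Measure α} [IsFiniteMeasure ν]
    {f : α → ℝ} (hf : Measurable f) {C : ℝ} (h0 : ∀ x, 0 ≤ f x) (h1 : ∀ x, f x ≤ C)
    (p : ENNReal) : MemLp f p ν :=
  MemLp.of_bound hf.aestronglyMeasurable C (ae_of_all _ fun x => by
    rw [Real.norm_eq_abs, abs_of_nonneg (h0 x)]; exact h1 x)

namespace BlockCode

variable (s : BlockCode K)

theorem measurable_code_mismatch (b : ℕ) (E : FullShift K → FullShift K) (hE : Measurable E) :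
    Measurable fun x => mismatch b x (E x) :=
  (measurable_mismatch b).comp (measurable_id.prodMk hE)

/-- Points without a good phase are replaced by one fixed good point. Thus every code word, without
exception, comes from a good phase, while points having a good phase are coded from themselves. -/
theorem exists_measurable_concat [Nonempty K] (b M : ℕ) (G : ℕ → Set (FullShift K))
    (hG : ∀ i, MeasurableSet (G i)) (hne : ∃ i, (G i).Nonempty) :
    ∃ E : FullShift K → FullShift K, Measurable E ∧
      ∀ x, ∃ i y, y ∈ G i ∧ E x = s.concat b M i y ∧ ((∃ i, x ∈ G i) → y = x) := by
  classical
  obtain ⟨i₀, y₀, h₀⟩ := hne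
  have hU : MeasurableSet {x | ∃ i, x ∈ G i} := by
    have : {x | ∃ i, x ∈ G i} = ⋃ i, G i := by ext; simp
    rw [this]; exact MeasurableSet.iUnion hG
  let ret : FullShift K → FullShift K := fun x => if ∃ i, x ∈ G i then x else y₀
  have hret : Measurable ret := Measurable.ite hU measurable_id measurable_const
  have hex : ∀ x, ∃ i, ret x ∈ G i := fun x => by
    by_cases h : ∃ i, x ∈ G i
    · simp [ret, h]
    · simp only [ret, h, if_false]; exact ⟨i₀, h₀⟩
  have hph : Measurable fun x => Nat.find (hex x) := measurable_find hex fun i => hret (hG i)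
  refine ⟨fun x => s.concat b M (Nat.find (hex x)) (ret x), ?_, fun x =>
    ⟨Nat.find (hex x), ret x, Nat.find_spec (hex x), rfl, fun h => by simp only [ret, h, if_true]⟩⟩
  have : Measurable fun q : ℕ × FullShift K => s.concat b M q.1 q.2 :=
    measurable_from_prod_countable_right fun i => s.measurable_concat b M i
  exact this.comp (hph.prodMk hret)

/-- The inductive step: the new code words are chains of old ones, have almost equal frequencies of
the words in `V`, and cost little additional error because the chosen phase has average error at
most slightly above the mean. -/
theorem exists_refinement [Nonempty K] {ν : Measure (FullShift K)} [IsProbabilityMeasure ν]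
    (hν : Ergodic (shift K) ν) {δ : ℝ} (hδ : 0 < δ) (hδ1 : δ ≤ 1) (V : Finset (Word K))
    (hV : ∀ v ∈ V, (v.1 : ℝ) ≤ δ * s.len) (N : ℕ) :
    ∃ s' : BlockCode K, N ≤ s'.len ∧ s'.err ν ≤ s.err ν + 3 * δ ∧
      (∀ z a c, s'.IsBlock z a c → Relation.ReflTransGen (s.IsBlock z) a c) ∧
      ∃ p : Word K → ℝ, ∀ v ∈ V, ∀ b x, s'.len ≤ b →
        |occ v b (s'.code b x) - p v * b| ≤ 3 * δ * b := by
  classical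
  have hℓ := s.len_pos
  have hℓ' : (0 : ℝ) < s.len := by exact_mod_cast hℓ
  let h : FullShift K → ℝ := fun x => mismatch s.len x (s.code s.len x)
  let f : V → FullShift K → ℝ := fun v x => occ v.1 s.len (s.code s.len x)
  have hhm : Measurable h := measurable_code_mismatch _ _ (s.measurable_code _)
  have hfm : ∀ v, Measurable (f v) := fun v => (measurable_occ _ _).comp (s.measurable_code _)
  obtain ⟨P, hP⟩ := exists_phase_averages hν (ℓ := s.len) (f := f) (h := h)
    (fun v => memLp_of_nonneg_of_le (hfm v) (fun x => occ_nonneg _ _ _) (fun x => occ_le _ _ _) 2)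
    (memLp_of_nonneg_of_le hhm (fun x => mismatch_nonneg _ _ _) (fun x => mismatch_le _ _ _) 2)
    hℓ (mul_pos hδ hℓ')
  have hhint : ∫ x, h x ∂ν = s.err ν * s.len := by
    simp only [BlockCode.err, h]; field_simp
  rw [hhint] at hP
  have hη : 0 < ENNReal.ofReal (δ / 2) := by simpa using hδ
  obtain ⟨M₀, hM₀⟩ := eventually_atTop.1 (hP _ hη)
  let G : ℕ → ℕ → Set (FullShift K) := fun M i => {x | s.len ≤ i ∧ i < 2 * s.len ∧
      (∀ v, |birkhoffAverage ℝ (shift K)^[s.len] (f v) M ((shift K)^[i] x) - P v| ≤ δ * s.len) ∧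
      birkhoffAverage ℝ (shift K)^[s.len] h M ((shift K)^[i] x) ≤
        s.err ν * s.len + δ * s.len}
  have hbav : ∀ (g : FullShift K → ℝ), Measurable g → ∀ M i, Measurable fun x =>
      birkhoffAverage ℝ (shift K)^[s.len] g M ((shift K)^[i] x) := fun g hg M i => by
    simp only [birkhoffAverage, smul_eq_mul]
    exact (((measurable_birkhoffSum (measurable_shift.iterate _) hg M).comp
      (measurable_shift.iterate i))).const_mul _
  have hGm : ∀ M i, MeasurableSet (G M i) := by
    intro M i
    simp only [G, measurableSet_setOfPred]
    refine Measurable.and measurable_const (Measurable.and measurable_const (Measurable.and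
      (Measurable.forall fun v => ?_) ?_))
    · exact measurableSet_setOfPred.1 (measurableSet_le ((hbav _ (hfm v) M i).sub_const _).abs
        measurable_const)
    · exact measurableSet_setOfPred.1 (measurableSet_le (hbav _ hhm M i) measurable_const)
  have hGν : ∀ M, M₀ ≤ M → ν {x | ¬ ∃ i, x ∈ G M i} ≤ ENNReal.ofReal (δ / 2) := hM₀
  -- The exceptional set has measure at most `δ / 2 < 1`.
  have hGne : ∀ M, M₀ ≤ M → ∃ i, (G M i).Nonempty := by
    intro M hM
    by_contra hc
    push Not at hc
    have h1 : {x | ¬ ∃ i, x ∈ G M i} = Set.univ := by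
      ext x; simp [hc]
    have h2 := hGν M hM
    rw [h1, measure_univ, ENNReal.one_le_ofReal] at h2
    linarith
  have hPle : ∀ v, |P v| ≤ 2 * s.len := by
    intro v
    obtain ⟨i, x, hx⟩ := hGne (M₀ + 1) (by omega)
    have h1 := abs_le.1 (hx.2.2.1 v)
    have h2 := nat_mul_birkhoffAverage_iterate (f := shift K) (g := f v) s.len i (M₀ + 1) x
    have h3 : 0 ≤ ∑ j ∈ Finset.range (M₀ + 1), f v ((shift K)^[i + j * s.len] x) :=
      Finset.sum_nonneg fun _ _ => occ_nonneg _ _ _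
    have h4 : ∑ j ∈ Finset.range (M₀ + 1), f v ((shift K)^[i + j * s.len] x) ≤
        (M₀ + 1 : ℕ) * s.len :=
      (Finset.sum_le_sum fun _ _ => occ_le _ _ _).trans (by simp)
    rw [← h2] at h3 h4
    have h5 : (0 : ℝ) < (M₀ + 1 : ℕ) := by positivity
    have h6 := nonneg_of_mul_nonneg_right h3 h5
    have h7 := le_of_mul_le_mul_left h4 h5
    have h8 : δ * s.len ≤ s.len := mul_le_of_le_one_left hℓ'.le hδ1
    rw [abs_le]; constructor <;> linarith
  choose E hEm hE using fun b : {b : ℕ // (M₀ + 3) * s.len ≤ b} =>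
    s.exists_measurable_concat b.1 (b.1 / s.len - 3) (G (b.1 / s.len - 3)) (hGm _) (hGne _ (by
      have := (Nat.le_div_iff_mul_le hℓ).2 b.2
      omega))
  -- The outer pieces have total length at most `5 * s.len`. They enter the frequency estimate once
  -- directly and twice through `|p| ≤ 2`, hence the `15`.
  set L := max N (max ((M₀ + 3) * s.len) (⌈15 * s.len / δ⌉₊)) with hL
  have hLN : N ≤ L := le_max_left _ _
  have hLM : (M₀ + 3) * s.len ≤ L := (le_max_left _ _).trans (le_max_right _ _)
  have hLδ : ∀ b : ℕ, L ≤ b → 15 * s.len ≤ δ * b := by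
    intro b hb
    have h1 : ⌈15 * s.len / δ⌉₊ ≤ b := ((le_max_right _ _).trans (le_max_right _ _)).trans hb
    have h2 := (Nat.ceil_le.1 h1)
    rw [div_le_iff₀ hδ] at h2
    linarith
  -- Leaving out three full blocks gives first and last pieces of admissible length for every phase.
  have hdecomp : ∀ b i, L ≤ b → s.len ≤ i → i < 2 * s.len → ∃ r, s.len ≤ r ∧ r ≤ 3 * s.len ∧
      b = i + (b / s.len - 3) * s.len + r := by
    intro b i hb hi hi'
    have h1 : 3 ≤ b / s.len := by
      have := (Nat.le_div_iff_mul_le hℓ).2 (hLM.trans hb)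
      omega
    have h2 := Nat.div_add_mod b s.len
    have h3 := Nat.mod_lt b hℓ
    have h4 : (b / s.len - 3) * s.len + 3 * s.len = s.len * (b / s.len) := by
      rw [← Nat.add_mul, Nat.sub_add_cancel h1, mul_comm]
    exact ⟨b - i - (b / s.len - 3) * s.len, by omega, by omega, by omega⟩
  let s' : BlockCode K :=
    { len := L
      len_pos := lt_of_lt_of_le (Nat.mul_pos (by omega) hℓ) hLM
      code := fun b => if hb : (M₀ + 3) * s.len ≤ b then E ⟨b, hb⟩ else id
      measurable_code := fun b => by
        by_cases hb : (M₀ + 3) * s.len ≤ b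
        · simp only [hb, dif_pos]; exact hEm _
        · simp only [hb, dif_neg, not_false_eq_true]; exact measurable_id }
  have hs' : ∀ b x, L ≤ b → ∃ i y, y ∈ G (b / s.len - 3) i ∧
      s'.code b x = s.concat b (b / s.len - 3) i y ∧
      ((∃ i, x ∈ G (b / s.len - 3) i) → y = x) := by
    intro b x hb
    have hb' := hLM.trans hb
    simp only [s', hb', dif_pos]
    exact hE ⟨b, hb'⟩ x
  refine ⟨s', hLN, ?_, ?_, fun v => if hv : v ∈ V then P ⟨v, hv⟩ / s.len else 0, ?_⟩
  · have hLpos : (0 : ℝ) < L := by exact_mod_cast s'.len_pos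
    set B : Set (FullShift K) := {x | ¬ ∃ i, x ∈ G (L / s.len - 3) i} with hB
    have hBm : MeasurableSet B := by
      have : B = (⋃ i, G (L / s.len - 3) i)ᶜ := by ext; simp [hB]
      rw [this]; exact (MeasurableSet.iUnion fun i => hGm _ i).compl
    have hBν : ν.real B ≤ δ := by
      refine (ENNReal.toReal_le_of_le_ofReal (by positivity) (hGν _ ?_)).trans (by linarith)
      have := (Nat.le_div_iff_mul_le hℓ).2 hLM
      omega
    -- One `δ` comes from the phase and one from the outer pieces; on the exceptional set `B` all
    -- symbols may change, which costs a third.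
    have hpt : ∀ x, mismatch L x (s'.code L x) ≤
        L * (s.err ν + 2 * δ) + B.indicator (fun _ => (L : ℝ)) x := by
      have herr : 0 ≤ s.err ν :=
        div_nonneg (integral_nonneg fun x => mismatch_nonneg _ _ _) hℓ'.le
      intro x
      by_cases hx : x ∈ B
      · rw [Set.indicator_of_mem hx]
        have := mismatch_le L x (s'.code L x)
        have : (0 : ℝ) ≤ L * (s.err ν + 2 * δ) := by positivity
        linarith
      · rw [Set.indicator_of_notMem hx, add_zero]
        obtain ⟨i, y, hy, hcode, hyx⟩ := hs' L x le_rfl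
        have hyx := hyx (not_not.1 hx)
        subst hyx
        obtain ⟨r, hr, hr', hdec⟩ := hdecomp L i le_rfl hy.1 hy.2.1
        rw [hcode]
        refine (s.mismatch_concat_le y hdec).trans ?_
        have h1 := nat_mul_birkhoffAverage_iterate (f := shift K) (g := h) s.len i
          (L / s.len - 3) y
        change _ = ∑ j ∈ _, mismatch s.len _ _ at h1
        rw [← h1]
        have h2 := mul_le_mul_of_nonneg_left hy.2.2.2 (Nat.cast_nonneg (α := ℝ) (L / s.len - 3))
        have h3 : (L : ℝ) = i + (L / s.len - 3 : ℕ) * s.len + r := by exact_mod_cast hdec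
        have h4 : (i : ℝ) < 2 * s.len := by exact_mod_cast hy.2.1
        have h5 : (r : ℝ) ≤ 3 * s.len := by exact_mod_cast hr'
        have h6 := hLδ L le_rfl
        have h7 : ((L / s.len - 3 : ℕ) : ℝ) * s.len ≤ L := by
          rw [h3]
          have : (0 : ℝ) ≤ i + r := by positivity
          linarith
        have h8 := mul_le_mul_of_nonneg_right h7 (add_nonneg herr hδ.le)
        nlinarith
    have hint : ∫ x, mismatch L x (s'.code L x) ∂ν ≤ L * (s.err ν + 2 * δ) + L * δ := by
      refine (integral_mono ?_ ?_ hpt).trans ?_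
      · exact (memLp_of_nonneg_of_le (measurable_code_mismatch _ _ (s'.measurable_code _))
          (fun x => mismatch_nonneg _ _ _) (fun x => mismatch_le _ _ _) 1).integrable le_rfl
      · exact (integrable_const _).add ((integrable_const _).indicator hBm)
      · rw [integral_add (integrable_const _) ((integrable_const _).indicator hBm),
          integral_const, integral_indicator_const _ hBm]
        simp only [smul_eq_mul, probReal_univ, one_mul]
        have := mul_le_mul_of_nonneg_right hBν hLpos.le
        linarith
    change (∫ x, mismatch L x (s'.code L x) ∂ν) / L ≤ _
    rw [div_le_iff₀ hLpos]
    linarith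
  · rintro z a c ⟨b, x, hb, hb', rfl, hz⟩
    obtain ⟨i, y, hy, hcode, -⟩ := hs' b x hb
    obtain ⟨r, hr, hr', hdec⟩ := hdecomp b i hb hy.1 hy.2.1
    rw [hcode] at hz
    exact s.reflTransGen_isBlock_of_concat hz hdec hy.1 (by have := hy.2.1; omega) hr hr'
  · intro v hv b x hb
    obtain ⟨i, y, hy, hcode, -⟩ := hs' b x hb
    obtain ⟨r, hr, hr', hdec⟩ := hdecomp b i hb hy.1 hy.2.1
    rw [hcode]
    simp only [hv, dif_pos]
    have h0 := s.abs_occ_concat_sub_le y hdec v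
    have h1 := nat_mul_birkhoffAverage_iterate (f := shift K) (g := f ⟨v, hv⟩) s.len i
          (b / s.len - 3) y
    change _ = ∑ j ∈ _, occ v s.len _ at h1
    rw [← h1] at h0
    set M := b / s.len - 3
    set A := birkhoffAverage ℝ (shift K)^[s.len] (f ⟨v, hv⟩) M ((shift K)^[i] y)
    set p := P ⟨v, hv⟩ / s.len with hp
    have hPp : P ⟨v, hv⟩ = p * s.len := by rw [hp]; field_simp
    have hple : |p| ≤ 2 := by
      rw [hp, abs_div, abs_of_pos hℓ', div_le_iff₀ hℓ']; exact hPle _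
    have h2 : |A - p * s.len| ≤ δ * s.len := hPp ▸ hy.2.2.1 ⟨v, hv⟩
    have h3 : (b : ℝ) = i + M * s.len + r := by exact_mod_cast hdec
    have h4 : (i : ℝ) < 2 * s.len := by exact_mod_cast hy.2.1
    have h5 : (r : ℝ) ≤ 3 * s.len := by exact_mod_cast hr'
    have h6 := hLδ b hb
    have hM : (0 : ℝ) ≤ M := Nat.cast_nonneg _
    have h7 : (M : ℝ) * |A - p * s.len| ≤ M * (δ * s.len) := mul_le_mul_of_nonneg_left h2 hM
    have h8 : (M : ℝ) * v.1 ≤ M * (δ * s.len) := mul_le_mul_of_nonneg_left (hV v hv) hM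
    have h9 : |p * (i + r)| ≤ 2 * (i + r) := by
      rw [abs_mul, abs_of_nonneg (show (0 : ℝ) ≤ i + r by positivity)]
      exact mul_le_mul_of_nonneg_right hple (by positivity)
    have h10 : δ * ((M : ℝ) * s.len) ≤ δ * b := by
      refine mul_le_mul_of_nonneg_left ?_ hδ.le
      rw [h3]
      have : (0 : ℝ) ≤ i + r := by positivity
      linarith
    -- The three terms are the count at junctions and outer pieces, the deviation of the phase
    -- average, and the share of the outer pieces in `p * b`; together at most `2 * δ * b + 15 *
    -- s.len`.
    have h11 : occ v b (s.concat b M i y) - p * b =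
        (occ v b (s.concat b M i y) - M * A) + M * (A - p * s.len) - p * (i + r) := by
      rw [h3]; ring
    rw [h11]
    refine (abs_sub _ _).trans ((add_le_add_left (abs_add_le _ _) _).trans ?_)
    rw [abs_mul (M : ℝ), abs_of_nonneg hM]
    nlinarith

end BlockCode

/-! ### From blocks to arbitrary windows. -/

section Windows

variable {r : ℕ → ℕ → Prop} {g : ℕ}

theorem Relation.ReflTransGen.exists_cut (hr : ∀ a c, r a c → a ≤ c ∧ c ≤ a + g) {x y a : ℕ}
    (h : Relation.ReflTransGen r x y) (hx : x ≤ a) (hy : a ≤ y) :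
    ∃ m, Relation.ReflTransGen r m y ∧ Relation.ReflTransGen r x m ∧ a ≤ m ∧ m ≤ a + g := by
  induction h with
  | refl => exact ⟨x, .refl, .refl, hy, by omega⟩
  | @tail b c hb hc ih =>
    by_cases hab : a ≤ b
    · obtain ⟨m, h1, h2, h3⟩ := ih hab
      exact ⟨m, h1.tail hc, h2, h3⟩
    · exact ⟨c, .refl, hb.tail hc, hy, by have := (hr _ _ hc).2; omega⟩

theorem abs_sub_le_of_forall_succ {d : ℕ → ℝ} {C : ℝ} (hC : ∀ m, |d (m + 1) - d m| ≤ C)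
    (a b : ℕ) : |d (a + b) - d a| ≤ C * b := by
  induction b with
  | zero => simp
  | succ b ih =>
    have h := hC (a + b)
    rw [← add_assoc]
    push_cast
    rw [abs_le] at *
    constructor <;> linarith [h.1, h.2, ih.1, ih.2]

theorem abs_sub_le_of_reflTransGen {d : ℕ → ℝ} {D : ℝ}
    (hd : ∀ a c, r a c → |d c - d a| ≤ D * ((c : ℝ) - a)) {x y : ℕ}
    (h : Relation.ReflTransGen r x y) : |d y - d x| ≤ D * ((y : ℝ) - x) := by
  induction h with
  | refl => simp
  | @tail b c _ hc ih =>
    have h := hd _ _ hc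
    rw [abs_le] at *
    constructor <;> linarith [h.1, h.2, ih.1, ih.2]

/-- If a function on `ℕ` is nearly constant on the steps of an infinite chain with bounded gaps,
then it varies slowly on all intervals. -/
theorem abs_sub_le_of_unbounded_chain (hr : ∀ a c, r a c → a ≤ c ∧ c ≤ a + g) {d : ℕ → ℝ}
    {C D : ℝ} (hD : 0 ≤ D) (hC : ∀ m, |d (m + 1) - d m| ≤ C)
    (hd : ∀ a c, r a c → |d c - d a| ≤ D * ((c : ℝ) - a))
    (hun : ∀ m, ∃ T, m ≤ T ∧ Relation.ReflTransGen r 0 T) (a b : ℕ) :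
    |d (a + b) - d a| ≤ D * b + (D + 2 * C) * g := by
  have hC0 : 0 ≤ C := (abs_nonneg _).trans (hC 0)
  obtain ⟨T, hT, h0T⟩ := hun (a + b)
  obtain ⟨m₁, h1, -, ham, hma⟩ := h0T.exists_cut hr (Nat.zero_le a) (by omega)
  obtain ⟨u, rfl⟩ := Nat.exists_eq_add_of_le ham
  have hu : (u : ℝ) ≤ g := by exact_mod_cast (by omega : u ≤ g)
  have e1 := abs_sub_le_of_forall_succ hC a u
  have c1 := mul_le_mul_of_nonneg_left hu hC0
  have hg : (0 : ℝ) ≤ g := Nat.cast_nonneg _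
  -- Either a cut point lies in the window, and then the chain controls all but two end pieces of
  -- length at most `g`, or the window is itself shorter than `g`.
  by_cases hm : a + u ≤ a + b
  · obtain ⟨m₂, -, h2, hbm, hmb⟩ := h1.exists_cut hr hm hT
    obtain ⟨t, rfl⟩ := Nat.exists_eq_add_of_le hbm
    have ht : (t : ℝ) ≤ g := by exact_mod_cast (by omega : t ≤ g)
    have e2 := abs_sub_le_of_forall_succ hC (a + b) t
    have e3 := abs_sub_le_of_reflTransGen hd h2
    have c2 := mul_le_mul_of_nonneg_left ht hC0
    have c3 : D * (((a + b + t : ℕ) : ℝ) - (a + u : ℕ)) ≤ D * (b + g) := by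
      refine mul_le_mul_of_nonneg_left ?_ hD
      push_cast
      have : (0 : ℝ) ≤ u := Nat.cast_nonneg _
      linarith
    rw [abs_le] at *
    constructor <;> linarith [e1.1, e1.2, e2.1, e2.2, e3.1, e3.2]
  · have e2 := abs_sub_le_of_forall_succ hC a b
    have hb : (b : ℝ) ≤ g := by exact_mod_cast (by omega : b ≤ g)
    have c2 := mul_le_mul_of_nonneg_left hb hC0
    have : 0 ≤ D * b := by positivity
    have : 0 ≤ D * g := by positivity
    have : 0 ≤ C * g := by positivity
    linarith

end Windows

/-! ### The sequence of codes and its uniform frequencies. -/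

theorem occ_add (v : Word K) (a b : ℕ) (z : FullShift K) :
    occ v (a + b) z = occ v a z + occ v b ((shift K)^[a] z) :=
  birkhoffSum_add _ _ _ _ _

theorem occ_one (v : Word K) (z : FullShift K) : occ v 1 z = cylInd v z := by
  simp [occ]

namespace BlockCode

variable (s : BlockCode K)

theorem IsBlock.bounds {s : BlockCode K} {z : FullShift K} {a c : ℕ} (h : s.IsBlock z a c) :
    a ≤ c ∧ c ≤ a + 3 * s.len := by
  obtain ⟨b, x, h1, h2, rfl, -⟩ := h
  omega

/-- The discrepancy `occ v m z - p * m` varies slowly along the chain of blocks. The additional `δ`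
absorbs occurrences of `v` that overlap the end of a block. -/
theorem abs_occ_window_le {v : Word K} {p D δ : ℝ} (hD : 0 ≤ D) (hδ : 0 ≤ δ)
    (hv : (v.1 : ℝ) ≤ δ * s.len)
    (hs : ∀ b x, s.len ≤ b → |occ v b (s.code b x) - p * b| ≤ D * b) {z : FullShift K}
    (hz : ∀ m, ∃ T, m ≤ T ∧ Relation.ReflTransGen (s.IsBlock z) 0 T) (a b : ℕ) :
    |occ v b ((shift K)^[a] z) - p * b| ≤
      (D + δ) * b + (D + δ + 2 * (1 + |p|)) * (3 * s.len : ℕ) := by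
  have key := abs_sub_le_of_unbounded_chain (d := fun m => occ v m z - p * m) (C := 1 + |p|)
    (fun _ _ h => IsBlock.bounds h) (add_nonneg hD hδ) (fun m => ?_) (fun a c h => ?_) hz a b
  · simp only [occ_add] at key
    push_cast at key ⊢
    convert key using 2
    ring
  · rw [occ_add, occ_one]
    have h1 := cylInd_nonneg v ((shift K)^[m] z)
    have h2 := cylInd_le_one v ((shift K)^[m] z)
    have h3 := abs_le.1 (le_refl |p|)
    push_cast
    rw [abs_le]; constructor <;> linarith
  · obtain ⟨b, x, h1, h2, rfl, h3⟩ := h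
    rw [occ_add]
    have e1 := hs b x h1
    have e2 : |occ v b ((shift K)^[a] z) - occ v b (s.code b x)| ≤ v.1 :=
      abs_occ_sub_le fun m hm => by rw [shift_iterate_apply, h3 m hm]
    have e3 : δ * s.len ≤ δ * b := mul_le_mul_of_nonneg_left (by exact_mod_cast h1) hδ
    push_cast
    rw [abs_le] at *
    constructor <;> nlinarith [e1.1, e1.2, e2.1, e2.2]

/-- The periodic point obtained by repeating the code word of length `len`. -/
def periodicCode (x : FullShift K) : FullShift K := fun m => s.code s.len x (m % s.len)

theorem measurable_periodicCode : Measurable s.periodicCode :=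
  measurable_pi_iff.2 fun _ => (measurable_pi_apply _).comp (s.measurable_code _)

theorem reflTransGen_periodicCode (x : FullShift K) (t : ℕ) :
    Relation.ReflTransGen (s.IsBlock (s.periodicCode x)) 0 (t * s.len) := by
  induction t with
  | zero => simpa using Relation.ReflTransGen.refl
  | succ t ih =>
    refine ih.tail ⟨s.len, x, le_rfl, by omega, by rw [Nat.succ_mul], fun m hm => ?_⟩
    simp only [periodicCode]
    rw [Nat.mul_add_mod_self_right, Nat.mod_eq_of_lt hm]

/-- The code changing nothing. -/
def trivial (K : Finset ℂ) : BlockCode K where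
  len := 1
  len_pos := one_pos
  code _ := id
  measurable_code _ := measurable_id

theorem mismatch_self (b : ℕ) (x : FullShift K) : mismatch b x x = 0 := by
  simp [mismatch_eq_sum, mismatchInd]

theorem exists_seq [Nonempty K] {ν : Measure (FullShift K)} [IsProbabilityMeasure ν]
    (hν : Ergodic (shift K) ν) {ε : ℝ} (hε : 0 < ε) (hε1 : ε ≤ 1) (w : ℕ → Word K) :
    ∃ S : ℕ → BlockCode K, (∀ n, n ≤ (S n).len) ∧ (∀ n, (S n).err ν ≤ ε) ∧
      (∀ n, ∀ j < n, ((w j).1 : ℝ) ≤ ε / 6 * (1 / 2) ^ n * (S n).len) ∧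
      (∀ n z a c, (S (n + 1)).IsBlock z a c → Relation.ReflTransGen ((S n).IsBlock z) a c) ∧
      ∃ p : ℕ → Word K → ℝ, ∀ n, ∀ j < n, ∀ b x, (S (n + 1)).len ≤ b →
        |occ (w j) b ((S (n + 1)).code b x) - p n (w j) * b| ≤
          3 * (ε / 6 * (1 / 2) ^ n) * b := by
  classical
  -- Level `n` adds error `3 * δ n = ε / 2 * (1 / 2) ^ n`, so the total error before level `n` is at
  -- most `ε * (1 - (1 / 2) ^ n)`.
  set δ : ℕ → ℝ := fun n => ε / 6 * (1 / 2) ^ n with hδ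
  have hδ0 : ∀ n, 0 < δ n := fun n => by positivity
  have hδ1 : ∀ n, δ n ≤ 1 := fun n => by
    have h1 : ((1 : ℝ) / 2) ^ n ≤ 1 := pow_le_one₀ (by norm_num) (by norm_num)
    have h2 := mul_le_mul_of_nonneg_left h1 (by positivity : 0 ≤ ε / 6)
    simp only [hδ]
    linarith
  let Q : ℕ → BlockCode K → Prop := fun n s =>
    n ≤ s.len ∧ s.err ν ≤ ε * (1 - (1 / 2) ^ n) ∧ ∀ j < n, ((w j).1 : ℝ) ≤ δ n * s.len
  have step : ∀ n (s : {s // Q n s}), ∃ s' : {s // Q (n + 1) s},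
      (∀ z a c, s'.1.IsBlock z a c → Relation.ReflTransGen (s.1.IsBlock z) a c) ∧
      ∃ p : Word K → ℝ, ∀ j < n, ∀ b x, s'.1.len ≤ b →
        |occ (w j) b (s'.1.code b x) - p (w j) * b| ≤ 3 * δ n * b := by
    rintro n ⟨s, hs0, hs1, hs2⟩
    obtain ⟨s', h1, h2, h3, p, h4⟩ := s.exists_refinement hν (hδ0 n) (hδ1 n)
      ((Finset.range n).image w) (by simpa using hs2)
      (max (n + 1) ((Finset.range (n + 1)).sup fun j => ⌈(w j).1 / δ (n + 1)⌉₊))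
    refine ⟨⟨s', (le_max_left _ _).trans h1, ?_, fun j hj => ?_⟩, h3, p, fun j hj => ?_⟩
    · refine h2.trans ((add_le_add_left hs1 _).trans (le_of_eq ?_))
      simp only [hδ, pow_succ]
      ring
    · have h5 : ⌈(w j).1 / δ (n + 1)⌉₊ ≤ s'.len :=
        (Finset.le_sup (f := fun j => ⌈(w j).1 / δ (n + 1)⌉₊) (Finset.mem_range.2 hj)).trans
          ((le_max_right _ _).trans h1)
      have h6 := Nat.ceil_le.1 h5
      rw [div_le_iff₀ (hδ0 _)] at h6
      linarith
    · exact h4 _ (Finset.mem_image_of_mem _ (Finset.mem_range.2 hj))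
  choose next hnext p hp using step
  have hQ0 : Q 0 (trivial K) := by
    refine ⟨Nat.zero_le _, ?_, by simp⟩
    simp [err, trivial, mismatch_self]
  let S : ∀ n, {s // Q n s} := fun n => Nat.rec ⟨trivial K, hQ0⟩ (fun k s => next k s) n
  refine ⟨fun n => (S n).1, fun n => (S n).2.1, fun n => (S n).2.2.1.trans ?_, fun n => (S n).2.2.2,
    fun n => hnext n (S n), fun n => p n (S n), fun n => hp n (S n)⟩
  have : (0 : ℝ) ≤ (1 / 2) ^ n := by positivity
  nlinarith

end BlockCode

/-- Every ergodic process is coded, changing few symbols, into sequences in which words have uniform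
frequencies. -/
theorem exists_uniform_coding [Nonempty K] {ν : Measure (FullShift K)} [IsProbabilityMeasure ν]
    (hν : Ergodic (shift K) ν) {ε : ℝ} (hε : 0 < ε) (hε1 : ε ≤ 1) (w : ℕ → Word K) :
    ∃ (N : ℕ → ℕ) (Φ : ℕ → FullShift K → FullShift K) (η : ℕ → ℝ) (p R : ℕ → Word K → ℝ),
      (∀ n, 0 < N n) ∧ Tendsto N atTop atTop ∧ (∀ n, Measurable (Φ n)) ∧
      (∀ n, ∫ x, mismatch (N n) x (Φ n x) ∂ν ≤ ε * N n) ∧ Tendsto η atTop (𝓝 0) ∧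
      ∀ k n, k < n → ∀ j < k, ∀ x a b, |occ (w j) b ((shift K)^[a] (Φ n x)) - p k (w j) * b| ≤
        η k * b + R k (w j) := by
  obtain ⟨S, hSn, hSe, hSw, hSb, p, hp⟩ := BlockCode.exists_seq hν hε hε1 w
  have hblocks : ∀ k n, k ≤ n → ∀ z a c, (S n).IsBlock z a c →
      Relation.ReflTransGen ((S k).IsBlock z) a c := by
    intro k n hkn
    induction n, hkn using Nat.le_induction with
    | base => exact fun z a c h => .single h
    | succ n _ ih =>
      intro z a c h
      replace h := hSb n z a c h
      induction h with
      | refl => exact .refl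
      | tail _ h2 ih2 => exact ih2.trans (ih _ _ _ h2)
  refine ⟨fun n => (S n).len, fun n => (S n).periodicCode,
    fun n => 3 * (ε / 6 * (1 / 2) ^ n) + ε / 6 * (1 / 2) ^ (n + 1), p,
    fun n v => (3 * (ε / 6 * (1 / 2) ^ n) + ε / 6 * (1 / 2) ^ (n + 1) + 2 * (1 + |p n v|)) *
      (3 * (S (n + 1)).len : ℕ), fun n => (S n).len_pos, tendsto_atTop_mono hSn tendsto_id,
    fun n => (S n).measurable_periodicCode, fun n => ?_, ?_, fun k n hkn j hj x a b => ?_⟩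
  · have h1 := hSe n
    have h2 : (0 : ℝ) < (S n).len := by exact_mod_cast (S n).len_pos
    rw [BlockCode.err, div_le_iff₀ h2] at h1
    refine le_of_eq_of_le ?_ h1
    congr 1
    ext x
    refine mismatch_congr_right fun m hm => ?_
    simp only [BlockCode.periodicCode, Nat.mod_eq_of_lt hm]
  · have h1 : Tendsto (fun n : ℕ => ((1 : ℝ) / 2) ^ n) atTop (𝓝 0) :=
      tendsto_pow_atTop_nhds_zero_of_lt_one (by norm_num) (by norm_num)
    have h2 := (h1.const_mul (3 * (ε / 6))).add
      ((h1.comp (tendsto_add_atTop_nat 1)).const_mul (ε / 6))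
    simp only [mul_zero, add_zero] at h2
    refine h2.congr fun n => ?_
    simp only [Function.comp_apply]
    ring
  -- The periodic sequence of level `n` is an endless chain of level `k + 1` blocks, so the bound
  -- depends on neither `n` nor `x`.
  · refine (S (k + 1)).abs_occ_window_le (by positivity) (by positivity)
      (hSw (k + 1) j (by omega)) (hp k j hj) (fun m => ?_) a b
    refine ⟨m * (S n).len, Nat.le_mul_of_pos_right _ (S n).len_pos, ?_⟩
    have h1 := (S n).reflTransGen_periodicCode x m
    generalize m * (S n).len = T at h1
    induction h1 with
    | refl => exact .refl
    | tail _ h2 ih => exact ih.trans (hblocks (k + 1) n hkn _ _ _ h2)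

/-! ### Invariant limits of orbit averages. -/

section OrbitAverages

variable {Z : Type*} [MeasurableSpace Z]

/-- The average of the images of `κ` under the first `N` iterates of `T`. -/
noncomputable def orbitAverage (T : Z → Z) (κ : Measure Z) (N : ℕ) : Measure Z :=
  (N : ENNReal)⁻¹ • ∑ t ∈ Finset.range N, κ.map T^[t]

theorem isProbabilityMeasure_orbitAverage {T : Z → Z} (hT : Measurable T) {κ : Measure Z}
    [IsProbabilityMeasure κ] {N : ℕ} (hN : 0 < N) :
    IsProbabilityMeasure (orbitAverage T κ N) := by
  refine ⟨?_⟩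
  have h : ∀ t ∈ Finset.range N, κ.map T^[t] Set.univ = 1 := fun t _ => by
    rw [Measure.map_apply (hT.iterate t) .univ, Set.preimage_univ, measure_univ]
  rw [orbitAverage, Measure.smul_apply, Measure.finsetSum_apply, Finset.sum_congr rfl h]
  simp only [Finset.sum_const, Finset.card_range, nsmul_eq_mul, mul_one, smul_eq_mul]
  exact ENNReal.inv_mul_cancel (by simpa using hN.ne') (by simp)

theorem orbitAverage_apply_eq_zero {T : Z → Z} (hT : Measurable T) {κ : Measure Z} {N : ℕ}
    {s : Set Z} (hs : MeasurableSet s) (h : ∀ t, κ (T^[t] ⁻¹' s) = 0) :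
    orbitAverage T κ N s = 0 := by
  rw [orbitAverage, Measure.smul_apply, Measure.finsetSum_apply, Finset.sum_eq_zero fun t _ => by
    rw [Measure.map_apply (hT.iterate t) hs, h], smul_zero]

variable [TopologicalSpace Z] [CompactSpace Z] [BorelSpace Z]

theorem Continuous.integrable_of_compactSpace {E : Type*} [NormedAddCommGroup E]
    [SecondCountableTopology E] {F : Z → E} (hF : Continuous F) (κ : Measure Z)
    [IsFiniteMeasure κ] : Integrable F κ :=
  hF.integrable_of_hasCompactSupport (HasCompactSupport.of_compactSpace F)

theorem integral_orbitAverage {E : Type*} [NormedAddCommGroup E] [NormedSpace ℝ E]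
    [SecondCountableTopology E] {T : Z → Z} (hT : Continuous T)
    {κ : Measure Z} [IsProbabilityMeasure κ] (N : ℕ) {F : Z → E} (hF : Continuous F) :
    ∫ z, F z ∂(orbitAverage T κ N) =
      (N : ℝ)⁻¹ • ∑ t ∈ Finset.range N, ∫ z, F (T^[t] z) ∂κ := by
  rw [orbitAverage, integral_smul_measure, integral_finsetSum_measure]
  · congr 1
    · simp
    · refine Finset.sum_congr rfl fun t _ => ?_
      rw [integral_map (hT.iterate t).measurable.aemeasurable hF.aestronglyMeasurable]
  · intro t _
    have := Measure.isProbabilityMeasure_map (μ := κ) (hT.iterate t).measurable.aemeasurable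
    exact hF.integrable_of_compactSpace _

/-- Averages of measures along longer and longer orbit segments accumulate at an invariant
measure. -/
theorem exists_invariant_limit_orbitAverage [T2Space Z] [HasOuterApproxClosed Z] {T : Z → Z}
    (hT : Continuous T) (κ : ℕ → Measure Z) [∀ n, IsProbabilityMeasure (κ n)] {N : ℕ → ℕ}
    (hN0 : ∀ n, 0 < N n) (hN : Tendsto N atTop atTop) :
    ∃ π : Measure Z, IsProbabilityMeasure π ∧ MeasurePreserving T π π ∧
      (∃ U : Ultrafilter ℕ, (U : Filter ℕ) ≤ atTop ∧
        (∀ F : Z → ℝ, Continuous F → Tendsto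
          (fun n => (N n : ℝ)⁻¹ • ∑ t ∈ Finset.range (N n), ∫ z, F (T^[t] z) ∂κ n) U
          (𝓝 (∫ z, F z ∂π))) ∧
        (∀ F : Z → ℂ, Continuous F → Tendsto
          (fun n => (N n : ℝ)⁻¹ • ∑ t ∈ Finset.range (N n), ∫ z, F (T^[t] z) ∂κ n) U
          (𝓝 (∫ z, F z ∂π)))) ∧
      ∀ C : Set Z, IsClosed C → (∀ᶠ n in atTop, ∀ t, ∀ᵐ z ∂κ n, T^[t] z ∈ C) → π Cᶜ = 0 := by
  let m : ℕ → ProbabilityMeasure Z := fun n =>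
    ⟨orbitAverage T (κ n) (N n), isProbabilityMeasure_orbitAverage hT.measurable (hN0 n)⟩
  obtain ⟨U, hU⟩ := Ultrafilter.exists_le (atTop : Filter ℕ)
  obtain ⟨π, hπ⟩ : ∃ π, Tendsto m U (𝓝 π) :=
    (U.map m).le_nhds_lim |> fun h => ⟨_, h⟩
  have hreal : ∀ F : Z → ℝ, Continuous F → Tendsto
      (fun n => (N n : ℝ)⁻¹ • ∑ t ∈ Finset.range (N n), ∫ z, F (T^[t] z) ∂κ n) U
      (𝓝 (∫ z, F z ∂(π : Measure Z))) := fun F hF => by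
    have := ProbabilityMeasure.tendsto_iff_forall_integral_tendsto.1 hπ
      (BoundedContinuousFunction.mkOfCompact ⟨F, hF⟩)
    refine this.congr fun n => ?_
    exact integral_orbitAverage hT (N n) hF
  have hcomplex : ∀ F : Z → ℂ, Continuous F → Tendsto
      (fun n => (N n : ℝ)⁻¹ • ∑ t ∈ Finset.range (N n), ∫ z, F (T^[t] z) ∂κ n) U
      (𝓝 (∫ z, F z ∂(π : Measure Z))) := fun F hF => by
    have := (ProbabilityMeasure.tendsto_iff_forall_integral_rclike_tendsto ℂ).1 hπ
      (BoundedContinuousFunction.mkOfCompact ⟨F, hF⟩)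
    refine this.congr fun n => ?_
    exact integral_orbitAverage hT (N n) hF
  refine ⟨π, inferInstance, ⟨hT.measurable, ?_⟩, ⟨U, hU, hreal, hcomplex⟩, fun C hC hev => ?_⟩
  · have := Measure.isProbabilityMeasure_map (μ := (π : Measure Z)) hT.measurable.aemeasurable
    refine ext_of_forall_integral_eq_of_IsFiniteMeasure fun F => ?_
    rw [integral_map hT.measurable.aemeasurable F.continuous.aestronglyMeasurable]
    have h1 := hreal _ (F.continuous.comp hT)
    have h2 := hreal _ F.continuous
    -- Applying `T` shifts the average by one step, so the difference telescopes to at most `2 * ‖F‖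
    -- / N n`.
    refine sub_eq_zero.1 (tendsto_nhds_unique (h1.sub h2) ?_)
    have h3 : Tendsto (fun n => 2 * ‖F‖ * (N n : ℝ)⁻¹) U (𝓝 0) := by
      have := ((tendsto_inv_atTop_zero.comp
        (tendsto_natCast_atTop_atTop (R := ℝ))).comp hN).const_mul (2 * ‖F‖)
      simpa using this.mono_left hU
    refine squeeze_zero_norm (fun n => ?_) h3
    have h4 : ∀ t, ‖∫ z, F (T^[t] z) ∂κ n‖ ≤ ‖F‖ := fun t => by
      refine (norm_integral_le_of_norm_le_const (ae_of_all _ fun z => F.norm_coe_le_norm _)).trans ?_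
      simp
    rw [← smul_sub, ← Finset.sum_sub_distrib]
    have h5 : ∀ t, ∫ z, (F ∘ T) (T^[t] z) ∂κ n = ∫ z, F (T^[t + 1] z) ∂κ n := fun t => by
      simp only [Function.comp_apply, ← Function.iterate_succ_apply' T]
    simp only [h5]
    rw [Finset.sum_range_sub (fun t => ∫ z, F (T^[t] z) ∂κ n), norm_smul, norm_inv,
      Real.norm_natCast, mul_comm]
    refine mul_le_mul_of_nonneg_right ((norm_sub_le _ _).trans ?_) (by positivity)
    linarith [h4 (N n), h4 0]
  · have h1 := ProbabilityMeasure.limsup_measure_closed_le_of_tendsto hπ hC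
    have h2 : (fun n => (m n : Measure Z) C) =ᶠ[(U : Filter ℕ)] fun _ => 1 := by
      filter_upwards [hU hev] with n hn
      rw [← prob_compl_eq_zero_iff hC.measurableSet]
      exact orbitAverage_apply_eq_zero hT.measurable hC.measurableSet.compl fun t => hn t
    rw [limsup_congr h2, limsup_const] at h1
    rw [prob_compl_eq_zero_iff hC.measurableSet]
    exact le_antisymm prob_le_one h1

end OrbitAverages

/-! ### Uniform frequencies and strict ergodicity. -/

theorem integral_birkhoffSum_of_measurePreserving {α : Type*} [MeasurableSpace α] {f : α → α}
    {ρ : Measure α} (hf : MeasurePreserving f ρ ρ) {g : α → ℝ} (hg : Integrable g ρ) (n : ℕ) :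
    ∫ x, birkhoffSum f g n x ∂ρ = n * ∫ x, g x ∂ρ := by
  simp only [birkhoffSum]
  rw [integral_finsetSum (f := fun k x => g (f^[k] x)) _ fun k _ =>
    ((hf.iterate k).integrable_comp hg.aestronglyMeasurable).2 hg]
  have : ∀ k, ∫ x, g (f^[k] x) ∂ρ = ∫ x, g x ∂ρ := fun k => by
    have h := (hf.iterate k).map_eq
    conv_rhs => rw [← h]
    rw [integral_map (hf.iterate k).measurable.aemeasurable
      (by rw [h]; exact hg.aestronglyMeasurable)]
  simp [this]

theorem measure_ext_of_integral_cylInd {ρ ρ' : Measure (FullShift K)} [IsFiniteMeasure ρ]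
    [IsFiniteMeasure ρ'] (h : ∀ v, ∫ z, cylInd v z ∂ρ = ∫ z, cylInd v z ∂ρ') : ρ = ρ' := by
  have hcyl : ∀ v : Word K, ρ {z | ∀ i : Fin v.1, z i = v.2 i} =
      ρ' {z | ∀ i : Fin v.1, z i = v.2 i} := fun v => by
    have h1 := h v
    have hm := (isClopen_cylinder v).isOpen.measurableSet
    simp only [cylInd_eq_indicator] at h1
    rw [integral_indicator_one hm, integral_indicator_one hm] at h1
    exact (ENNReal.toReal_eq_toReal_iff' (measure_ne_top _ _) (measure_ne_top _ _)).1 h1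
  refine IsProjectiveLimit.unique (P := fun I : Finset ℕ => ρ.map I.restrict) (fun I => rfl)
    fun I => ?_
  obtain ⟨m, hm⟩ : ∃ m, I ⊆ Finset.range m := I.exists_nat_subset_range
  have hrm : ρ'.map (Finset.range m).restrict = ρ.map (Finset.range m).restrict := by
    refine Measure.ext_of_singleton fun u => ?_
    rw [Measure.map_apply (by fun_prop) (measurableSet_singleton _),
      Measure.map_apply (by fun_prop) (measurableSet_singleton _)]
    have : (Finset.range m).restrict (π := fun _ => K) ⁻¹' {u} = {z : FullShift K | ∀ i : Fin m,
        z i = u ⟨i, Finset.mem_range.2 i.2⟩} := by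
      ext z
      simp only [Set.mem_preimage, Set.mem_singleton_iff, Set.mem_ofPred_eq]
      constructor
      · rintro rfl i; rfl
      · intro hz
        ext ⟨i, hi⟩
        exact congrArg Subtype.val (hz ⟨i, Finset.mem_range.1 hi⟩)
    rw [this]
    exact (hcyl ⟨m, fun i => u ⟨i, Finset.mem_range.2 i.2⟩⟩).symm
  have hcomp : (I.restrict : FullShift K → _) =
      Finset.restrict₂ hm ∘ (Finset.range m).restrict := rfl
  change _ = ρ.map I.restrict
  rw [hcomp, ← Measure.map_map (by fun_prop) (by fun_prop), hrm,
    Measure.map_map (by fun_prop) (by fun_prop)]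

/-- Integrating the window bound against an invariant measure on `X` and letting `b` grow puts the
measure of each cylinder within `η k` of `p k (w j)`. Two such measures thus differ by at most `2 *
η k`, which tends to zero; the `p k` need not be known to converge. -/
theorem eq_of_uniform_frequencies {w : ℕ → Word K} (hw : Function.Surjective w) {η : ℕ → ℝ}
    (hη : Tendsto η atTop (𝓝 0)) {p R : ℕ → Word K → ℝ} {X : Set (FullShift K)}
    (hX : ∀ z ∈ X, ∀ k, ∀ j < k, ∀ b, |occ (w j) b z - p k (w j) * b| ≤ η k * b + R k (w j))
    {ρ ρ' : Measure (FullShift K)} (hρ : IsShiftInvariant ρ) (hρX : ρ Xᶜ = 0)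
    (hρ' : IsShiftInvariant ρ') (hρX' : ρ' Xᶜ = 0) : ρ = ρ' := by
  have key : ∀ ρ : Measure (FullShift K), IsShiftInvariant ρ → ρ Xᶜ = 0 → ∀ k, ∀ j < k,
      |∫ z, cylInd (w j) z ∂ρ - p k (w j)| ≤ η k := by
    intro ρ hρ hρX k j hj
    have := hρ.isProbabilityMeasure
    have hint : Integrable (cylInd (w j)) ρ := (continuous_cylInd _).integrable_of_compactSpace ρ
    have hb : ∀ b : ℕ, |∫ z, cylInd (w j) z ∂ρ - p k (w j)| * b ≤ η k * b + R k (w j) := by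
      intro b
      have h1 : ∫ z, (occ (w j) b z - p k (w j) * b) ∂ρ =
          (∫ z, cylInd (w j) z ∂ρ - p k (w j)) * b := by
        have hi : Integrable (occ (w j) b) ρ :=
          (memLp_of_nonneg_of_le (measurable_occ _ _) (occ_nonneg _ _) (occ_le _ _) 1).integrable
            le_rfl
        rw [integral_sub hi (integrable_const _)]
        simp only [occ]
        rw [integral_birkhoffSum_of_measurePreserving hρ.measurePreserving hint]
        simp
        ring
      have h2 : ‖∫ z, (occ (w j) b z - p k (w j) * b) ∂ρ‖ ≤ (η k * b + R k (w j)) * ρ.real .univ :=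
        norm_integral_le_of_norm_le_const (by
          filter_upwards [(show ∀ᵐ z ∂ρ, z ∈ X from hρX)] with z hz
          exact hX z hz k j hj b)
      rw [h1, Real.norm_eq_abs, abs_mul, Nat.abs_cast, probReal_univ, mul_one] at h2
      exact h2
    by_contra hc
    push Not at hc
    obtain ⟨b, hb'⟩ := exists_nat_gt (R k (w j) / (|∫ z, cylInd (w j) z ∂ρ - p k (w j)| - η k))
    rw [div_lt_iff₀ (by linarith)] at hb'
    linarith [hb b]
  have := hρ.isProbabilityMeasure
  have := hρ'.isProbabilityMeasure
  refine measure_ext_of_integral_cylInd fun v => ?_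
  obtain ⟨j, rfl⟩ := hw v
  have h1 : Tendsto (fun k => 2 * η k) atTop (𝓝 0) := by simpa using hη.const_mul 2
  have h2 : |∫ z, cylInd (w j) z ∂ρ - ∫ z, cylInd (w j) z ∂ρ'| ≤ 0 := by
    refine ge_of_tendsto h1 ?_
    filter_upwards [eventually_gt_atTop j] with k hk
    have h3 := key ρ hρ hρX k j hk
    have h4 := key ρ' hρ' hρX' k j hk
    rw [abs_le] at *
    constructor <;> linarith [h3.1, h3.2, h4.1, h4.2]
  exact sub_eq_zero.1 (abs_nonpos_iff.1 h2)

theorem mapsTo_support_of_measurePreserving {ρ : Measure (FullShift K)}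
    (hρ : MeasurePreserving (shift K) ρ ρ) : Set.MapsTo (shift K) ρ.support ρ.support := by
  intro x hx
  rw [Measure.mem_support_iff_forall] at hx ⊢
  intro V hV
  obtain ⟨V', hV', hVo, hxV⟩ := mem_nhds_iff.1 hV
  have h1 := hx _ (continuous_shift.continuousAt.preimage_mem_nhds (hVo.mem_nhds hxV))
  rw [hρ.measure_preimage hVo.measurableSet.nullMeasurableSet] at h1
  exact h1.trans_le (measure_mono hV')

/-- Krylov–Bogolyubov, by averaging a point mass along its orbit. -/
theorem IsSubshift.exists_isShiftInvariant {Y : Set (FullShift K)} (hY : IsSubshift Y) :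
    ∃ ρ : Measure (FullShift K), IsShiftInvariant ρ ∧ ρ Yᶜ = 0 := by
  obtain ⟨y, hy⟩ := hY.nonempty
  obtain ⟨π, h1, h2, -, h3⟩ := exists_invariant_limit_orbitAverage (continuous_shift (K := K))
    (fun _ => Measure.dirac y) (N := fun n => n + 1) (fun n => n.succ_pos)
    (tendsto_add_atTop_nat 1)
  refine ⟨π, ⟨h1, h2⟩, h3 Y hY.isClosed (Eventually.of_forall fun _ t => ?_)⟩
  rw [ae_dirac_iff ((continuous_shift.iterate t).measurable hY.isClosed.measurableSet)]
  exact hY.mapsTo.iterate t hy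

/-- Any subshift inside the support carries an invariant measure, which must be `ρ`; hence it
contains the whole support. -/
theorem isStrictlyErgodicMeasure_of_unique {ρ : Measure (FullShift K)} (hρ : IsShiftInvariant ρ)
    {X : Set (FullShift K)} (hX : IsClosed X) (hρX : ρ Xᶜ = 0)
    (huniq : ∀ ρ' : Measure (FullShift K), IsShiftInvariant ρ' → ρ' Xᶜ = 0 → ρ' = ρ) :
    IsStrictlyErgodicMeasure ρ := by
  have := hρ.isProbabilityMeasure
  have hsub : ρ.support ⊆ X := Measure.support_subset_of_isClosed hX hρX
  have huniq' : ∀ ρ' : Measure (FullShift K), IsShiftInvariant ρ' → ρ' ρ.supportᶜ = 0 → ρ' = ρ :=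
    fun ρ' h1 h2 => huniq ρ' h1 (measure_mono_null (Set.compl_subset_compl.2 hsub) h2)
  refine ⟨hρ, ⟨⟨Measure.nonempty_support (IsProbabilityMeasure.ne_zero ρ),
    Measure.isClosed_support, mapsTo_support_of_measurePreserving hρ.measurePreserving⟩,
    fun Y hY hYs => ?_, ρ, ⟨hρ, Measure.measure_compl_support⟩, fun ρ' h => huniq' ρ' h.1 h.2⟩⟩
  obtain ⟨ρ', h1, h2⟩ := hY.exists_isShiftInvariant
  have h3 := huniq' ρ' h1 (measure_mono_null (Set.compl_subset_compl.2 hYs) h2)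
  subst h3
  exact hYs.antisymm (Measure.support_subset_of_isClosed hY.isClosed h2)

theorem IsStrictlyErgodicMeasure.isErgodicMeasure {ν : Measure (FullShift K)}
    (hν : IsStrictlyErgodicMeasure ν) : IsErgodicMeasure ν := by
  have hinv := hν.isShiftInvariant
  have := hinv.isProbabilityMeasure
  refine ⟨hinv, hinv.measurePreserving, ⟨fun s hs hfs => ?_⟩⟩
  rw [eventuallyConst_set']
  by_cases h0 : ν s = 0
  · exact Or.inl (ae_eq_empty.2 h0)
  refine Or.inr ?_
  have hcond : IsShiftInvariant (ProbabilityTheory.cond ν s) := by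
    refine ⟨ProbabilityTheory.cond_isProbabilityMeasure h0, ?_⟩
    have h1 := (hinv.measurePreserving.restrict_preimage hs).smul_measure (ν s)⁻¹
    rwa [hfs] at h1
  have hac : ProbabilityTheory.cond ν s ν.supportᶜ = 0 :=
    ProbabilityTheory.cond_absolutelyContinuous Measure.measure_compl_support
  have heq := hν.support.uniquelyErgodic.unique ⟨hcond, hac⟩ ⟨hinv, Measure.measure_compl_support⟩
  refine eventuallyEq_univ.2 (mem_ae_iff.2 ?_)
  rw [← heq, ProbabilityTheory.cond_apply hs]
  simp

/-! ### Perturbing joinings and the proof of the theorem. -/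

instance borelSpace_fullShift_prod : BorelSpace (FullShift K × FullShift K) := Prod.borelSpace

theorem continuous_occ (v : Word K) (b : ℕ) : Continuous (occ v b) := by
  unfold occ birkhoffSum
  exact continuous_finsetSum _ fun t _ => (continuous_cylInd v).comp (continuous_shift.iterate t)

theorem continuous_symbol : Continuous fun z : FullShift K => (z 0 : ℂ) :=
  continuous_subtype_val.comp (continuous_apply 0)

theorem norm_integral_le_one {α : Type*} [MeasurableSpace α] {ρ : Measure α}
    [IsProbabilityMeasure ρ] {F : α → ℂ} (hF : ∀ x, ‖F x‖ ≤ 1) : ‖∫ x, F x ∂ρ‖ ≤ 1 := by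
  refine (norm_integral_le_of_norm_le_const (ae_of_all _ hF)).trans ?_
  simp

theorem norm_jointValue_le (hK : ∀ z ∈ K, ‖z‖ ≤ 1) (p : FullShift K × FullShift K) :
    ‖(p.1 0 : ℂ) * (starRingEnd ℂ) (p.2 0 : ℂ)‖ ≤ 1 := by
  rw [norm_mul, RCLike.norm_conj]
  exact mul_le_one₀ (hK _ (p.1 0).2) (norm_nonneg _) (hK _ (p.2 0).2)

theorem bddAbove_joining_values (hK : ∀ z ∈ K, ‖z‖ ≤ 1) {μ ν : Measure (FullShift K)}
    [IsProbabilityMeasure μ] [IsProbabilityMeasure ν] :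
    BddAbove (Set.range fun ξ : {ξ : Measure (FullShift K × FullShift K) // IsJoining ξ μ ν} =>
      ‖(∫ p, (p.1 0 : ℂ) * (starRingEnd ℂ) (p.2 0 : ℂ) ∂ξ.1) -
        (∫ x, (x 0 : ℂ) ∂μ) * (∫ y, (starRingEnd ℂ) (y 0 : ℂ) ∂ν)‖) := by
  refine ⟨2, ?_⟩
  rintro _ ⟨⟨ξ, hξ⟩, rfl⟩
  have := hξ.isProbabilityMeasure
  have h1 : ‖∫ p, (p.1 0 : ℂ) * (starRingEnd ℂ) (p.2 0 : ℂ) ∂ξ‖ ≤ 1 :=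
    norm_integral_le_one (norm_jointValue_le hK)
  have h2 : ‖∫ x : FullShift K, (x 0 : ℂ) ∂μ‖ ≤ 1 := norm_integral_le_one fun x => hK _ (x 0).2
  have h3 : ‖∫ y : FullShift K, (starRingEnd ℂ) (y 0 : ℂ) ∂ν‖ ≤ 1 :=
    norm_integral_le_one fun y => by rw [RCLike.norm_conj]; exact hK _ (y 0).2
  refine (norm_sub_le _ _).trans ?_
  rw [norm_mul]
  have := mul_le_one₀ h2 (norm_nonneg _) h3
  linarith

theorem correlated_iff_exists_joining (hK : ∀ z ∈ K, ‖z‖ ≤ 1) {μ ν : Measure (FullShift K)}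
    [IsProbabilityMeasure μ] [IsProbabilityMeasure ν] :
    Correlated μ ν ↔ ∃ ξ, IsJoining ξ μ ν ∧
      0 < ‖(∫ p, (p.1 0 : ℂ) * (starRingEnd ℂ) (p.2 0 : ℂ) ∂ξ) -
        (∫ x, (x 0 : ℂ) ∂μ) * (∫ y, (starRingEnd ℂ) (y 0 : ℂ) ∂ν)‖ := by
  constructor
  · intro h
    by_contra hc
    push Not at hc
    refine h ?_
    unfold corr
    rw [← Real.iSup_const_zero (ι := {ξ : Measure (FullShift K × FullShift K) // IsJoining ξ μ ν})]
    congr 1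
    ext ξ
    exact le_antisymm (hc ξ.1 ξ.2) (norm_nonneg _)
  · rintro ⟨ξ, hξ, hpos⟩
    exact (hpos.trans_le (le_ciSup (bddAbove_joining_values hK) ⟨ξ, hξ⟩)).ne'

/-- Changing the second coordinate by a coding which changes few symbols has little effect on
averages of functions depending on the first symbol of the second coordinate. -/
theorem norm_orbitAverage_coding_sub_le {ξ : Measure (FullShift K × FullShift K)}
    [IsProbabilityMeasure ξ] (hξ : MeasurePreserving (Prod.map (shift K) (shift K)) ξ ξ)
    {Φ : FullShift K → FullShift K} (hΦ : Measurable Φ) {N : ℕ} (hN : 0 < N) {ε : ℝ}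
    (hε : ∫ x, mismatch N x (Φ x) ∂(ξ.map Prod.snd) ≤ ε * N) {F : FullShift K × FullShift K → ℂ}
    (hF : Continuous F) (hFd : ∀ y x x', ‖F (y, x') - F (y, x)‖ ≤ 2 * mismatchInd (x, x')) :
    ‖(N : ℝ)⁻¹ • ∑ t ∈ Finset.range N, ∫ z, F ((Prod.map (shift K) (shift K))^[t] z)
      ∂(ξ.map fun p => (p.1, Φ p.2)) - ∫ p, F p ∂ξ‖ ≤ 2 * ε := by
  set T := Prod.map (shift K) (shift K) with hT
  have hTc : Continuous T := continuous_shift.prodMap continuous_shift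
  have hG : Measurable fun p : FullShift K × FullShift K => (p.1, Φ p.2) := by fun_prop
  have hNr : (0 : ℝ) < N := by exact_mod_cast hN
  have hcontT : ∀ t, Continuous fun z => F (T^[t] z) := fun t => hF.comp (hTc.iterate t)
  have hb : ∃ C, ∀ p, ‖F p‖ ≤ C := by
    obtain ⟨C, hC⟩ := isCompact_univ.exists_bound_of_continuousOn hF.continuousOn
    exact ⟨C, fun p => hC p trivial⟩
  obtain ⟨C, hC⟩ := hb
  have hi1 : ∀ t, Integrable (fun p : FullShift K × FullShift K => F (T^[t] (p.1, Φ p.2))) ξ :=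
    fun t => Integrable.of_bound (((hcontT t).measurable.comp hG).aestronglyMeasurable) C
      (ae_of_all _ fun p => hC _)
  have hi2 : ∀ t, Integrable (fun p => F (T^[t] p)) ξ := fun t =>
    (hcontT t).integrable_of_compactSpace ξ
  have h1 : ∀ t, ∫ z, F (T^[t] z) ∂(ξ.map fun p => (p.1, Φ p.2)) =
      ∫ p, F (T^[t] (p.1, Φ p.2)) ∂ξ := fun t =>
    integral_map hG.aemeasurable (hcontT t).aestronglyMeasurable
  have h2 : ∀ t, ∫ p, F p ∂ξ = ∫ p, F (T^[t] p) ∂ξ := fun t => by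
    conv_lhs => rw [← (hξ.iterate t).map_eq]
    exact integral_map (hξ.iterate t).measurable.aemeasurable hF.aestronglyMeasurable
  -- Invariance of `ξ` turns its integral into an orbit average, comparable time by time: at time
  -- `t` the difference is at most twice the mismatch of the `t`-th symbols.
  have h3 : ∫ p, F p ∂ξ = (N : ℝ)⁻¹ • ∑ t ∈ Finset.range N, ∫ p, F (T^[t] p) ∂ξ := by
    simp only [← h2]
    rw [Finset.sum_const, Finset.card_range, ← Nat.cast_smul_eq_nsmul ℝ, smul_smul,
      inv_mul_cancel₀ hNr.ne', one_smul]
  rw [h3]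
  simp only [h1]
  rw [← smul_sub, ← Finset.sum_sub_distrib]
  simp only [← integral_sub (hi1 _) (hi2 _)]
  rw [← integral_finsetSum (f := fun t p => F (T^[t] (p.1, Φ p.2)) - F (T^[t] p)) _
    fun t _ => (hi1 t).sub (hi2 t), norm_smul, norm_inv,
    Real.norm_natCast, inv_mul_le_iff₀ hNr]
  have hmm : Measurable fun x => mismatch N x (Φ x) :=
    BlockCode.measurable_code_mismatch N Φ hΦ
  rw [integral_map measurable_snd.aemeasurable hmm.aestronglyMeasurable] at hε
  have hmi : Integrable (fun p : FullShift K × FullShift K => mismatch N p.2 (Φ p.2)) ξ :=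
    (memLp_of_nonneg_of_le (hmm.comp measurable_snd) (fun _ => mismatch_nonneg _ _ _)
      (fun _ => mismatch_le _ _ _) 1).integrable le_rfl
  refine (norm_integral_le_of_norm_le (hmi.const_mul 2) (ae_of_all _ fun p => ?_)).trans ?_
  · rw [mismatch_eq_sum, Finset.mul_sum]
    refine norm_sum_le_of_le _ fun t _ => ?_
    simp only [hT, Prod.map_iterate]
    exact hFd _ _ _
  · rw [integral_const_mul]
    linarith

/-- The bound is stated for a class of functions `F` since the correlation needs it both for the
product of the two symbols and for the second symbol alone. -/
theorem exists_isStrictlyErgodicMeasure_joining {μ ν : Measure (FullShift K)}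
    (hν : IsErgodicMeasure ν) {ξ : Measure (FullShift K × FullShift K)} (hξ : IsJoining ξ μ ν)
    {ε : ℝ} (hε : 0 < ε) (hε1 : ε ≤ 1) :
    ∃ π : Measure (FullShift K × FullShift K), IsJoining π μ (π.map Prod.snd) ∧
      IsStrictlyErgodicMeasure (π.map Prod.snd) ∧ ∀ F : FullShift K × FullShift K → ℂ,
        Continuous F → (∀ y x x', ‖F (y, x') - F (y, x)‖ ≤ 2 * mismatchInd (x, x')) →
        ‖∫ p, F p ∂π - ∫ p, F p ∂ξ‖ ≤ 2 * ε := by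
  have := hν.isShiftInvariant.isProbabilityMeasure
  have := hξ.isProbabilityMeasure
  obtain ⟨x₀⟩ := nonempty_of_isProbabilityMeasure ν
  have : Nonempty K := ⟨x₀ 0⟩
  have : Nonempty (Word K) := ⟨⟨0, Fin.elim0⟩⟩
  obtain ⟨w, hw⟩ := exists_surjective_nat (Word K)
  obtain ⟨N, Φ, η, p, R, hN0, hN, hΦ, hmis, hη, hfreq⟩ :=
    exists_uniform_coding hν.ergodic hε hε1 w
  have hG : ∀ n, Measurable fun q : FullShift K × FullShift K => (q.1, Φ n q.2) := fun n =>
    measurable_fst.prodMk ((hΦ n).comp measurable_snd)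
  have hκ : ∀ n, IsProbabilityMeasure (ξ.map fun q => (q.1, Φ n q.2)) := fun n =>
    Measure.isProbabilityMeasure_map (hG n).aemeasurable
  have hTc : Continuous (Prod.map (shift K) (shift K)) :=
    continuous_shift.prodMap continuous_shift
  obtain ⟨π, hπ, hπT, ⟨U, hU, hUr, hUc⟩, hπC⟩ := exists_invariant_limit_orbitAverage hTc
    (fun n => ξ.map fun q => (q.1, Φ n q.2)) hN0 hN
  have hsnd : IsShiftInvariant (π.map Prod.snd) := by
    refine ⟨Measure.isProbabilityMeasure_map measurable_snd.aemeasurable, measurable_shift, ?_⟩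
    rw [Measure.map_map measurable_shift measurable_snd]
    conv_rhs => rw [← hπT.map_eq, Measure.map_map measurable_snd hTc.measurable]
    rfl
  have hfst : π.map Prod.fst = μ := by
    have := Measure.isProbabilityMeasure_map (μ := π) (measurable_fst.aemeasurable)
    have : IsProbabilityMeasure μ :=
      hξ.map_fst ▸ Measure.isProbabilityMeasure_map measurable_fst.aemeasurable
    refine ext_of_forall_integral_eq_of_IsFiniteMeasure fun F => ?_
    rw [integral_map measurable_fst.aemeasurable F.continuous.aestronglyMeasurable]
    refine tendsto_nhds_unique (hUr _ (F.continuous.comp continuous_fst)) ?_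
    refine tendsto_const_nhds.congr fun n => ?_
    -- The coding leaves the first coordinate untouched, so each term already equals the integral
    -- against `μ`.
    have h1 : ∀ t, ∫ z, (F ∘ Prod.fst) ((Prod.map (shift K) (shift K))^[t] z)
        ∂(ξ.map fun q => (q.1, Φ n q.2)) = ∫ y, F y ∂μ := fun t => by
      have h2 := integral_map (μ := ξ) (hG n).aemeasurable
        ((F.continuous.comp continuous_fst).comp (hTc.iterate t)).aestronglyMeasurable
      refine h2.trans ?_
      have h3 := integral_map (μ := ξ) (hξ.measurePreserving.iterate t).measurable.aemeasurable
        (F.continuous.comp continuous_fst).aestronglyMeasurable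
      rw [(hξ.measurePreserving.iterate t).map_eq] at h3
      rw [← hξ.map_fst, integral_map measurable_fst.aemeasurable
        F.continuous.aestronglyMeasurable]
      refine Eq.trans ?_ h3.symm
      simp only [Prod.map_iterate, Function.comp_apply, Prod.map]
    have hNr : (N n : ℝ) ≠ 0 := by exact_mod_cast (hN0 n).ne'
    refine ((congrArg ((N n : ℝ)⁻¹ • ·) (Finset.sum_congr rfl fun t _ => h1 t)).trans ?_).symm
    change (N n : ℝ)⁻¹ • ∑ _t ∈ Finset.range (N n), ∫ y, F y ∂μ = _
    rw [Finset.sum_const, Finset.card_range, ← Nat.cast_smul_eq_nsmul ℝ, smul_smul,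
      inv_mul_cancel₀ hNr, one_smul]
  let X : ℕ → Set (FullShift K) := fun k =>
    ⋂ j, ⋂ _ : j < k, ⋂ b, {z | |occ (w j) b z - p k (w j) * b| ≤ η k * b + R k (w j)}
  -- Cylinders are clopen, so word counts are continuous and the frequency bounds survive the weak
  -- limit.
  have hXc : ∀ k, IsClosed (X k) := fun k =>
    isClosed_iInter fun j => isClosed_iInter fun _ => isClosed_iInter fun b =>
      isClosed_le ((continuous_occ _ _).sub continuous_const).abs continuous_const
  have hXπ : π.map Prod.snd (⋂ k, X k)ᶜ = 0 := by
    rw [Measure.map_apply measurable_snd (isClosed_iInter hXc).measurableSet.compl]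
    have h1 : ∀ k, ∀ᵐ q ∂π, q.2 ∈ X k := fun k => by
      refine hπC _ ((hXc k).preimage continuous_snd) ?_
      filter_upwards [eventually_gt_atTop k] with n hn t
      refine (ae_map_iff (hG n).aemeasurable
        (((hXc k).preimage continuous_snd).preimage (hTc.iterate t)).measurableSet).2
          (ae_of_all _ fun q => ?_)
      change ((Prod.map (shift K) (shift K))^[t] (q.1, Φ n q.2)).2 ∈ X k
      simp only [Prod.map_iterate, Prod.map]
      refine Set.mem_iInter.2 fun j => Set.mem_iInter.2 fun hj => Set.mem_iInter.2 fun b => ?_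
      exact hfreq k n hn j hj q.2 t b
    have h2 : ∀ᵐ q ∂π, q.2 ∈ ⋂ k, X k := by
      filter_upwards [ae_all_iff.2 h1] with q hq using Set.mem_iInter.2 hq
    exact h2
  refine ⟨π, ⟨hπ, hπT, hfst, rfl⟩, isStrictlyErgodicMeasure_of_unique hsnd (isClosed_iInter hXc)
    hXπ fun ρ' h1 h2 => ?_, fun F hF hFd => ?_⟩
  · refine eq_of_uniform_frequencies (p := p) (R := R) hw hη (X := ⋂ k, X k)
      (fun z hz k j hj b => ?_) h1 h2 hsnd hXπ
    exact Set.mem_iInter.1 (Set.mem_iInter.1 (Set.mem_iInter.1 (Set.mem_iInter.1 hz k) j) hj) b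
  · refine le_of_tendsto ((hUc F hF).sub_const _).norm (Eventually.of_forall fun n => ?_)
    exact norm_orbitAverage_coding_sub_le hξ.measurePreserving (hΦ n) (hN0 n)
      (by rw [hξ.map_snd]; exact hmis n) hF hFd

theorem norm_symbol_sub_le (hK : ∀ z ∈ K, ‖z‖ ≤ 1) (x x' : FullShift K) :
    ‖(starRingEnd ℂ) (x' 0 : ℂ) - (starRingEnd ℂ) (x 0 : ℂ)‖ ≤ 2 * mismatchInd (x, x') := by
  rw [← map_sub, RCLike.norm_conj]
  unfold mismatchInd
  split_ifs with h
  · simp [show x 0 = x' 0 from h]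
  · refine (norm_sub_le _ _).trans ?_
    linarith [hK _ (x 0).2, hK _ (x' 0).2]

theorem theorem2p2 (K : Finset ℂ) (hK : ∀ z ∈ K, ‖z‖ ≤ 1)
    (μ : Measure (FullShift K)) (hμ : IsShiftInvariant μ) :
    (∃ ν : Measure (FullShift K), IsStrictlyErgodicMeasure ν ∧ Correlated μ ν) ↔
      (∃ ν : Measure (FullShift K), IsErgodicMeasure ν ∧ Correlated μ ν) := by
  have := hμ.isProbabilityMeasure
  constructor
  · rintro ⟨ν, hν, hc⟩
    exact ⟨ν, hν.isErgodicMeasure, hc⟩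
  rintro ⟨ν, hν, hc⟩
  have := hν.isShiftInvariant.isProbabilityMeasure
  obtain ⟨ξ, hξ, hpos⟩ := (correlated_iff_exists_joining hK).1 hc
  set c := ‖(∫ p, (p.1 0 : ℂ) * (starRingEnd ℂ) (p.2 0 : ℂ) ∂ξ) -
        (∫ x, (x 0 : ℂ) ∂μ) * (∫ y, (starRingEnd ℂ) (y 0 : ℂ) ∂ν)‖ with hcdef
  obtain ⟨π, hπ, hρ, hF⟩ := exists_isStrictlyErgodicMeasure_joining hν hξ
    -- Both the joint integral and the mean of the second symbol move by at most `c / 4`, so at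
    -- least `c / 2` of the correlation remains.
    (ε := min 1 (c / 8)) (lt_min one_pos (by positivity)) (min_le_left _ _)
  have hε : min 1 (c / 8) ≤ c / 8 := min_le_right _ _
  have := hρ.isShiftInvariant.isProbabilityMeasure
  refine ⟨π.map Prod.snd, hρ, (correlated_iff_exists_joining hK).2 ⟨π, hπ, ?_⟩⟩
  have hconj : Continuous fun z : FullShift K => (starRingEnd ℂ) (z 0 : ℂ) :=
    Complex.continuous_conj.comp continuous_symbol
  have h1 := hF (fun p => (p.1 0 : ℂ) * (starRingEnd ℂ) (p.2 0 : ℂ))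
    ((continuous_symbol.comp continuous_fst).mul (hconj.comp continuous_snd)) fun y x x' => by
      rw [← mul_sub, norm_mul]
      exact (mul_le_of_le_one_left (norm_nonneg _) (hK _ (y 0).2)).trans
        (norm_symbol_sub_le hK x x')
  have h2 := hF (fun p => (starRingEnd ℂ) (p.2 0 : ℂ)) (hconj.comp continuous_snd)
    fun _ x x' => norm_symbol_sub_le hK x x'
  have h3 : ∫ p, (starRingEnd ℂ) (p.2 0 : ℂ) ∂ξ = ∫ y, (starRingEnd ℂ) (y 0 : ℂ) ∂ν := by
    rw [← hξ.map_snd]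
    exact (integral_map measurable_snd.aemeasurable hconj.aestronglyMeasurable).symm
  have h4 : ∫ p, (starRingEnd ℂ) (p.2 0 : ℂ) ∂π =
      ∫ y, (starRingEnd ℂ) (y 0 : ℂ) ∂(π.map Prod.snd) :=
    (integral_map measurable_snd.aemeasurable hconj.aestronglyMeasurable).symm
  rw [h3, h4] at h2
  have h5 : ‖∫ x : FullShift K, (x 0 : ℂ) ∂μ‖ ≤ 1 := norm_integral_le_one fun x => hK _ (x 0).2
  set a := ∫ p, (p.1 0 : ℂ) * (starRingEnd ℂ) (p.2 0 : ℂ) ∂ξ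
  set a' := ∫ p, (p.1 0 : ℂ) * (starRingEnd ℂ) (p.2 0 : ℂ) ∂π
  set m := ∫ x : FullShift K, (x 0 : ℂ) ∂μ
  set n := ∫ y, (starRingEnd ℂ) (y 0 : ℂ) ∂ν
  set n' := ∫ y, (starRingEnd ℂ) (y 0 : ℂ) ∂(π.map Prod.snd)
  have h6 : a - m * n = (a' - m * n') - (a' - a) + m * (n' - n) := by ring
  have h7 : c ≤ ‖a' - m * n'‖ + ‖a' - a‖ + ‖n' - n‖ := by
    rw [hcdef, h6]
    refine (norm_add_le _ _).trans (add_le_add (norm_sub_le _ _) ?_)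
    rw [norm_mul]
    exact mul_le_of_le_one_left (norm_nonneg _) h5
  linarith
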